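/- Consider a WLAN with $N\ge 1$ stations whose channel can accommodate up to $M\ge 1$ simultaneous transmissions. Each station transmits in a generic slot with probability $\tau\in[0,1]$; idle, collision and success slots have lengths $T_{idle},T_{coll},T_{succ}>0$; packets arrive at a tagged station as a Poisson process of rate $\lambda>0$. The minimum contention window is an integer $W_0\ge 1$, the backoff factor is a real number $r>1$, and the contention window after $i$ failures of a packet is $W_i=r^iW_0$ (rounded to one of the two neighbouring integers when it is not an integer). Let $$p_c=1-\sum_{k=0}^{M-1}\binom{N-1}{k}\tau^k(1-\tau)^{N-1-k}$$ be the collision probability, and assume $p_c<1$. Let $L$ be the random length of a slot in which the tagged station does not transmit: $L$ equals $T_{idle}$, $T_{succ}$, $T_{coll}$ with respective probabilities $$(1-\tau)^{N-1},\qquad \sum_{k=1}^{M}\binom{N-1}{k}\tau^k(1-\tau)^{N-1-k},\qquad 1-\sum_{k=0}^{M}\binom{N-1}{k}\tau^k(1-\tau)^{N-1-k}.$$ Let $$X_{ne}=\sum_{i=1}^{R}\sum_{m=1}^{B_i}L_{i,m}+(R-1)T_{coll}+T_{succ},$$ where all the variables are independent, $\Pr\{R=j\}=p_c^{j-1}(1-p_c)$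 for $j\ge1$, $B_i$ is uniform on $\{0,\dots,W_{i-1}-1\}$, and the $L_{i,m}$ are distributed as $L$. Put $\tilde\rho=\lambda\,\mathrm{E}[X_{ne}]\in(0,\infty]$. The tagged station is the first-come-first-served M/G/1 queue with multiple vacations, with arrival rate $\lambda$, i.i.d. service times distributed as $X_{ne}$ and i.i.d. vacations distributed as $L$, arrivals, services and vacations being independent: whenever the queue becomes empty the server takes vacations one after another until, at the end of one of them, a packet is waiting, and then it starts to serve. Let $D$ be the steady-state packet delay (time from the arrival of a packet to the end of its service); that is, the law of $D$ is a probability law on $[0,\infty)$ such that, if one packet's delay has this law, so does the delay of the next packet. Then such a law is unique if it exists, and it exists if and only if $\tilde\rho<1$. The mean packet delay $\mathrm{E}[D]$ is finite (that is, $D$ exists and $\mathrm{E}[D]<\infty$) if and only if $\tilde\rho<1$ and $p_c<1/r^2$. The delay jitter $\mathrm{Var}[D]$ is finite (that is, $D$ exists and $\mathrm{Var}[D]<\infty$) if and only if $\tilde\rho<1$ and $p_c<1/r^3$. -/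

import Mathlib

open MeasureTheory ProbabilityTheory
open scoped ENNReal

noncomputable section

namespace MPRWLAN

/-- Probability that exactly `k` of `n` stations transmit in a slot, when each of them transmits
independently with probability `τ`. -/
def binomWeight (n : ℕ) (τ : ℝ) (k : ℕ) : ℝ :=
  (n.choose k : ℝ) * τ ^ k * (1 - τ) ^ (n - k)

/-- The probability that a transmission of the tagged station collides: at least `M` of the `N - 1`
other stations transmit in the same slot. -/
def collisionProb (N M : ℕ) (τ : ℝ) : ℝ :=
  1 - ∑ k ∈ Finset.range M, binomWeight (N - 1) τ k

/-- The parameters of an exponential-backoff WLAN with multipacket reception. -/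
structure Network where
  /-- number of stations -/
  N : ℕ
  /-- number of simultaneous transmissions that the channel can accommodate -/
  M : ℕ
  /-- probability that a station transmits in a generic slot -/
  τ : ℝ
  /-- packet arrival rate at a station -/
  rate : ℝ
  /-- lengths of idle, collision and success slots -/
  Tidle : ℝ
  Tcoll : ℝ
  Tsucc : ℝ
  /-- backoff factor -/
  r : ℝ
  /-- minimum contention window -/
  W₀ : ℕ
  /-- `window i` is the contention window, a whole number of slots, after `i` failures of a packet -/
  window : ℕ → ℕ
  N_pos : 1 ≤ N
  M_pos : 1 ≤ M
  τ_nonneg : 0 ≤ τ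
  τ_le_one : τ ≤ 1
  /-- a packet is eventually transmitted -/
  collisionProb_lt_one : collisionProb N M τ < 1
  rate_pos : 0 < rate
  Tidle_pos : 0 < Tidle
  Tcoll_pos : 0 < Tcoll
  Tsucc_pos : 0 < Tsucc
  one_lt_r : 1 < r
  W₀_pos : 1 ≤ W₀
  /-- The window is `r ^ i * W₀`, rounded in either direction where that is not an integer (and
  hence exactly `r ^ i * W₀` where it is one). -/
  window_spec : ∀ i, |(window i : ℝ) - r ^ i * W₀| < 1

lemma binomWeight_nonneg {n : ℕ} {τ : ℝ} (h0 : 0 ≤ τ) (h1 : τ ≤ 1) (k : ℕ) :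
    0 ≤ binomWeight n τ k := by
  have : 0 ≤ 1 - τ := by linarith
  unfold binomWeight
  positivity

lemma sum_binomWeight_le_one {n : ℕ} {τ : ℝ} (h0 : 0 ≤ τ) (h1 : τ ≤ 1) (m : ℕ) :
    ∑ k ∈ Finset.range m, binomWeight n τ k ≤ 1 := by
  have hfull : ∑ k ∈ Finset.range (n + 1), binomWeight n τ k = 1 := by
    have h := add_pow τ (1 - τ) n
    rw [add_sub_cancel, one_pow] at h
    rw [h]
    refine Finset.sum_congr rfl fun k _ => ?_
    unfold binomWeight
    ring
  have hz : ∀ k ∈ Finset.range (n + 1 + m), k ∉ Finset.range (n + 1) → binomWeight n τ k = 0 := by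
    intro k _ hk
    have : n < k := by simpa using hk
    simp [binomWeight, Nat.choose_eq_zero_of_lt this]
  rw [← hfull, Finset.sum_subset (Finset.range_mono (Nat.le_add_right (n + 1) m)) hz]
  exact Finset.sum_le_sum_of_subset_of_nonneg (Finset.range_mono (by omega))
    fun k _ _ => binomWeight_nonneg h0 h1 k

namespace Network

variable (S : Network)

/-- The collision probability `p_c`. -/
def pc : ℝ := collisionProb S.N S.M S.τ

lemma pc_nonneg : 0 ≤ S.pc := by
  have := sum_binomWeight_le_one (n := S.N - 1) S.τ_nonneg S.τ_le_one S.M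
  unfold pc collisionProb
  linarith

/-- Probabilities that a slot in which the tagged station does not transmit is idle, a collision,
or a success. -/
def Pidle : ℝ := (1 - S.τ) ^ (S.N - 1)

def Pcoll : ℝ := 1 - ∑ k ∈ Finset.range (S.M + 1), binomWeight (S.N - 1) S.τ k

def Psucc : ℝ := ∑ k ∈ Finset.Icc 1 S.M, binomWeight (S.N - 1) S.τ k

lemma Pidle_nonneg : 0 ≤ S.Pidle := pow_nonneg (by linarith [S.τ_le_one]) _

lemma Pcoll_nonneg : 0 ≤ S.Pcoll := by
  have := sum_binomWeight_le_one (n := S.N - 1) S.τ_nonneg S.τ_le_one (S.M + 1)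
  unfold Pcoll
  linarith

lemma Psucc_nonneg : 0 ≤ S.Psucc :=
  Finset.sum_nonneg fun k _ => binomWeight_nonneg S.τ_nonneg S.τ_le_one k

lemma P_sum : S.Pidle + S.Pcoll + S.Psucc = 1 := by
  have h : ∑ k ∈ Finset.range (S.M + 1), binomWeight (S.N - 1) S.τ k = S.Pidle + S.Psucc := by
    have h' : Finset.range (S.M + 1) = insert 0 (Finset.Icc 1 S.M) := by
      ext k
      simp only [Finset.mem_range, Finset.mem_insert, Finset.mem_Icc]
      omega
    rw [h', Finset.sum_insert (by simp)]
    simp [binomWeight, Pidle, Psucc]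
  unfold Pcoll
  rw [h]
  ring

/-- The law of the length `L` of a slot in which the tagged station does not transmit. This is the
law both of a countdown slot and of a vacation. -/
def slotLaw : Measure ℝ :=
  ENNReal.ofReal S.Pidle • Measure.dirac S.Tidle +
    ENNReal.ofReal S.Pcoll • Measure.dirac S.Tcoll +
      ENNReal.ofReal S.Psucc • Measure.dirac S.Tsucc

instance : IsProbabilityMeasure S.slotLaw := by
  constructor
  simp only [slotLaw, Measure.add_apply, Measure.smul_apply, measure_univ, smul_eq_mul, mul_one]
  rw [← ENNReal.ofReal_add S.Pidle_nonneg S.Pcoll_nonneg,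
    ← ENNReal.ofReal_add (add_nonneg S.Pidle_nonneg S.Pcoll_nonneg) S.Psucc_nonneg, S.P_sum,
    ENNReal.ofReal_one]

lemma window_pos (i : ℕ) : 0 < S.window i := by
  have h := (abs_lt.mp (S.window_spec i)).1
  have h1 : (1 : ℝ) ≤ S.r ^ i := one_le_pow₀ S.one_lt_r.le
  have h2 : (1 : ℝ) ≤ S.W₀ := by exact_mod_cast S.W₀_pos
  have h3 : (1 : ℝ) ≤ S.r ^ i * S.W₀ := one_le_mul_of_one_le_of_one_le h1 h2
  have h4 : (0 : ℝ) < S.window i := by linarith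
  exact_mod_cast h4

/-- The law of the number of countdown slots in the backoff period that follows the `i`-th failure:
uniform on `{0, …, window i - 1}`. -/
def backoffLaw (i : ℕ) : Measure ℕ := uniformOn (Set.Iio (S.window i))

instance (i : ℕ) : IsProbabilityMeasure (S.backoffLaw i) :=
  isProbabilityMeasure_uniformOn (Set.finite_Iio _) ⟨0, S.window_pos i⟩

/-- The law of the number of failed transmissions of a packet: `j` with probability
`p_c ^ j * (1 - p_c)`. -/
def failureLaw : Measure ℕ :=
  geometricMeasure ⟨1 - S.pc, by
    have : S.pc < 1 := S.collisionProb_lt_one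
    linarith, by linarith [S.pc_nonneg]⟩

instance : IsProbabilityMeasure S.failureLaw := isProbabilityMeasure_geometricMeasure

/-- The medium-access delay of a packet that arrives at a non-empty queue, when its transmission
fails `j` times before it succeeds, its `i`-th backoff period (counted from `0`) has `b i` slots,
and the `m`-th of these has length `l i m`. -/
def accessDelay (j : ℕ) (b : ℕ → ℕ) (l : ℕ → ℕ → ℝ) : ℝ :=
  (∑ i ∈ Finset.range (j + 1), ∑ m ∈ Finset.range (b i), l i m) + j * S.Tcoll + S.Tsucc

/-- The law of the medium-access delay `X_ne`: the number of failures, the backoff counters and the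
slot lengths are all independent. -/
def accessLaw : Measure ℝ :=
  (S.failureLaw.prod ((Measure.infinitePi S.backoffLaw).prod
    (Measure.infinitePi fun _ : ℕ => Measure.infinitePi fun _ : ℕ => S.slotLaw))).map
      fun ω => S.accessDelay ω.1 ω.2.1 ω.2.2

/-- `ρ̃ = λ E[X_ne]`, which may be `∞`. -/
def rhoTilde : ℝ≥0∞ :=
  ENNReal.ofReal S.rate * ∫⁻ x, ENNReal.ofReal x ∂S.accessLaw

end Network

/-- The first time, not before `u`, at which a vacation ends, when consecutive vacations of lengths
`v 0, v 1, …` are taken from time `0` on. -/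
def vacationEnd (v : ℕ → ℝ) (u : ℝ) : ℝ :=
  ∑ k ∈ Finset.range (sInf {n : ℕ | u ≤ ∑ k ∈ Finset.range n, v k}), v k

/-- The delay (time from arrival to end of service) of a packet in a first-come-first-served queue
with multiple vacations, when the preceding packet has delay `d`, the packet arrives a time `t`
after the preceding one, its service time is `x`, and `v` are the lengths of the vacations that the
server takes if the queue becomes empty.

Time is counted from the arrival of the preceding packet, which leaves at `d`. If the packet has
arrived by then, its service starts at `d`; otherwise the server takes vacations from `d` on, and
the service starts at the end of the vacation during which the packet arrives. -/
def nextDelay (d t x : ℝ) (v : ℕ → ℝ) : ℝ :=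
  (if t ≤ d then d else d + vacationEnd v (t - d)) + x - t

namespace Network

variable (S : Network)

/-- `μ` is a steady-state law of the packet delay `D` in the M/G/1 queue with multiple vacations,
with Poisson arrivals of rate `λ`, service times distributed as `X_ne` and vacations distributed
as `L`: if the delay of a packet has law `μ`, then so does the delay of the next packet. -/
structure IsSteadyStateDelay (μ : Measure ℝ) : Prop where
  isProbabilityMeasure : IsProbabilityMeasure μ
  nonneg : ∀ᵐ d ∂μ, 0 ≤ d
  stationary :
    (μ.prod ((expMeasure S.rate).prod (S.accessLaw.prod
      (Measure.infinitePi fun _ : ℕ => S.slotLaw)))).map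
        (fun ω => nextDelay ω.1 ω.2.1 ω.2.2.1 ω.2.2.2) = μ

end Network

end MPRWLAN

end

noncomputable section

namespace MPRWLAN

open Filter Topology Set

/-! Let `X` be the service law, `R` the law of the residual vacation met by a packet that finds the
queue empty, and `X_e`, `R_e` their equilibrium measures, for which `1 - X̂(s) = s X̂_e(s)`.
Conditioning one step of the delay recursion on whether the exponential interarrival time exceeds
the preceding delay, and using memorylessness, turns stationarity of `μ` into the renewal equation
`μ̂ = λ X̂_e μ̂ + ψ σ̂`. Here `ψ = μ̂(λ)` is the probability of finding the queue empty and `σ = X ∗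
(λ R_e + R)` (`laplace_nextDelayLaw_eq_iff`).

Letting `s ↓ 0` gives `1 = ρ̃ + ψ σ(ℝ)`. Hence `ρ̃ < 1`, and `ψ`, then `μ̂`, then `μ` are determined
(`stationary_unique`). Conversely, if `ρ̃ < 1`, the geometric compound `∑ (λ X_e)^{∗n} ∗ ψ σ` with
`ψ = (1 - ρ̃) / σ(ℝ)` is stationary (`nextDelayLaw_delayLaw`).

The `k`-th moment of `X_e` is finite exactly when the `(k+1)`-th moment of `X` is. Since `R` is
bounded, it follows for `k = 1, 2` that `E[D^k]` is finite exactly when `E[X^(k+1)]` is. After `j`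
failures the access delay is at most of order `r^j`, and at least of that order with probability at
least `1/2`. So `E[X^k]` converges or diverges with `∑ (p_c r^k)^j`
(`posMoment_accessLaw_lt_top_iff`), which gives the thresholds `1/r²` and `1/r³`. -/

/-! ### Laplace transforms and moments of measures on the half-line. -/

/-- The Laplace transform of a measure on the line. -/
def laplace (μ : Measure ℝ) (s : ℝ) : ℝ≥0∞ := ∫⁻ x, ENNReal.ofReal (Real.exp (-(s * x))) ∂μ

/-- The `k`-th moment of the positive part. -/
def posMoment (μ : Measure ℝ) (k : ℕ) : ℝ≥0∞ := ∫⁻ x, ENNReal.ofReal x ^ k ∂μ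

lemma posMoment_zero (μ : Measure ℝ) : posMoment μ 0 = μ univ := by simp [posMoment]

lemma laplace_add (μ ν : Measure ℝ) (s : ℝ) :
    laplace (μ + ν) s = laplace μ s + laplace ν s := lintegral_add_measure _ _ _

lemma laplace_smul (c : ℝ≥0∞) (μ : Measure ℝ) (s : ℝ) :
    laplace (c • μ) s = c * laplace μ s := by
  simp [laplace, lintegral_smul_measure]

lemma posMoment_add (μ ν : Measure ℝ) (k : ℕ) :
    posMoment (μ + ν) k = posMoment μ k + posMoment ν k := lintegral_add_measure _ _ _

lemma posMoment_smul (c : ℝ≥0∞) (μ : Measure ℝ) (k : ℕ) :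
    posMoment (c • μ) k = c * posMoment μ k := by
  simp [posMoment, lintegral_smul_measure]

lemma laplace_conv (μ ν : Measure ℝ) [SFinite μ] [SFinite ν] (s : ℝ) :
    laplace (μ.conv ν) s = laplace μ s * laplace ν s := by
  unfold laplace
  rw [Measure.lintegral_conv (by fun_prop)]
  have (x y : ℝ) : ENNReal.ofReal (Real.exp (-(s * (x + y)))) =
      ENNReal.ofReal (Real.exp (-(s * x))) * ENNReal.ofReal (Real.exp (-(s * y))) := by
    rw [← ENNReal.ofReal_mul (Real.exp_pos _).le, ← Real.exp_add]
    congr 2; ring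
  simp_rw [this]
  simp_rw [lintegral_const_mul _ (show Measurable fun y : ℝ =>
    ENNReal.ofReal (Real.exp (-(s * y))) by fun_prop)]
  rw [lintegral_mul_const _ (by fun_prop)]

lemma ae_nonneg_conv {μ ν : Measure ℝ} [SFinite μ] [SFinite ν]
    (hμ : ∀ᵐ x ∂μ, 0 ≤ x) (hν : ∀ᵐ x ∂ν, 0 ≤ x) : ∀ᵐ x ∂(μ.conv ν), 0 ≤ x := by
  unfold Measure.conv
  rw [ae_map_iff (by fun_prop) measurableSet_Ici]
  have h1 : ∀ᵐ p : ℝ × ℝ ∂μ.prod ν, 0 ≤ p.1 := Measure.quasiMeasurePreserving_fst.ae hμ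
  have h2 : ∀ᵐ p : ℝ × ℝ ∂μ.prod ν, 0 ≤ p.2 := Measure.quasiMeasurePreserving_snd.ae hν
  filter_upwards [h1, h2] with p h1 h2 using add_nonneg h1 h2

/-- On the half-line `ENNReal.ofReal` is additive, so truncation at `0` is harmless. The masses
`posMoment _ 0` stay because the renewal kernel has mass `ρ̃`, not `1`. -/
lemma posMoment_one_conv {μ ν : Measure ℝ} [SFinite μ] [SFinite ν]
    (hμ : ∀ᵐ x ∂μ, 0 ≤ x) (hν : ∀ᵐ x ∂ν, 0 ≤ x) :
    posMoment (μ.conv ν) 1 = posMoment μ 1 * posMoment ν 0 + posMoment μ 0 * posMoment ν 1 := by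
  have h : ∀ᵐ x ∂μ, ∫⁻ y, ENNReal.ofReal (x + y) ^ 1 ∂ν =
      ENNReal.ofReal x ^ 1 * posMoment ν 0 + posMoment ν 1 := by
    filter_upwards [hμ] with x hx
    have : ∀ᵐ y ∂ν, ENNReal.ofReal (x + y) ^ 1 = ENNReal.ofReal x + ENNReal.ofReal y := by
      filter_upwards [hν] with y hy
      rw [pow_one, ENNReal.ofReal_add hx hy]
    rw [lintegral_congr_ae this, lintegral_add_left (by fun_prop)]
    simp [posMoment]
  rw [posMoment, Measure.lintegral_conv (by fun_prop), lintegral_congr_ae h,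
    lintegral_add_left (by fun_prop), lintegral_mul_const _ (by fun_prop), lintegral_const,
    posMoment_zero μ, mul_comm (posMoment ν 1)]
  simp only [posMoment]

lemma posMoment_two_conv {μ ν : Measure ℝ} [SFinite μ] [SFinite ν]
    (hμ : ∀ᵐ x ∂μ, 0 ≤ x) (hν : ∀ᵐ x ∂ν, 0 ≤ x) :
    posMoment (μ.conv ν) 2 = posMoment μ 2 * posMoment ν 0 + 2 * (posMoment μ 1 * posMoment ν 1) +
      posMoment μ 0 * posMoment ν 2 := by
  have h : ∀ᵐ x ∂μ, ∫⁻ y, ENNReal.ofReal (x + y) ^ 2 ∂ν =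
      ENNReal.ofReal x ^ 2 * posMoment ν 0 + 2 * (ENNReal.ofReal x ^ 1 * posMoment ν 1) +
        posMoment ν 2 := by
    filter_upwards [hμ] with x hx
    have : ∀ᵐ y ∂ν, ENNReal.ofReal (x + y) ^ 2 = ENNReal.ofReal x ^ 2 +
        2 * (ENNReal.ofReal x * ENNReal.ofReal y) + ENNReal.ofReal y ^ 2 := by
      filter_upwards [hν] with y hy
      rw [ENNReal.ofReal_add hx hy]
      ring
    rw [lintegral_congr_ae this, lintegral_add_left (by fun_prop), lintegral_add_left (by fun_prop),
      lintegral_const_mul _ (by fun_prop), lintegral_const_mul _ (by fun_prop)]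
    simp [posMoment]
  rw [posMoment, Measure.lintegral_conv (by fun_prop), lintegral_congr_ae h,
    lintegral_add_left (by fun_prop), lintegral_add_left (by fun_prop),
    lintegral_mul_const _ (by fun_prop), lintegral_const_mul _ (by fun_prop),
    lintegral_mul_const _ (by fun_prop), lintegral_const,
    posMoment_zero μ, mul_comm (posMoment ν 2)]
  simp only [posMoment]

lemma laplace_le_mass {μ : Measure ℝ} (hμ : ∀ᵐ x ∂μ, 0 ≤ x) {s : ℝ} (hs : 0 ≤ s) :
    laplace μ s ≤ μ univ := by
  rw [← lintegral_one]
  refine lintegral_mono_ae ?_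
  filter_upwards [hμ] with x hx
  rw [ENNReal.ofReal_le_one, Real.exp_le_one_iff]
  nlinarith

lemma laplace_pos (μ : Measure ℝ) [NeZero μ] (s : ℝ) : 0 < laplace μ s := by
  rw [laplace, lintegral_pos_iff_support (by fun_prop)]
  have : Function.support (fun x : ℝ => ENNReal.ofReal (Real.exp (-(s * x)))) = univ := by
    ext x; simp [Real.exp_pos]
  rw [this]
  exact Measure.measure_univ_pos.mpr (NeZero.ne μ)

/-- As `s ↓ 0`, the Laplace transform tends to the total mass. -/
lemma tendsto_laplace {μ : Measure ℝ} (hμ : ∀ᵐ x ∂μ, 0 ≤ x) :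
    Tendsto (fun n : ℕ => laplace μ (1 / ((n : ℝ) + 1))) atTop (𝓝 (μ univ)) := by
  rw [← lintegral_one]
  refine lintegral_tendsto_of_tendsto_of_monotone (fun n => by fun_prop) ?_ ?_
  · filter_upwards [hμ] with x hx n m hnm
    refine ENNReal.ofReal_le_ofReal (Real.exp_le_exp.mpr (neg_le_neg ?_))
    gcongr
  · refine ae_of_all _ fun x => ?_
    have h : Tendsto (fun n : ℕ => Real.exp (-(1 / ((n : ℝ) + 1) * x))) atTop
        (𝓝 (Real.exp (-(0 * x)))) :=
      (Real.continuous_exp.tendsto _).comp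
        ((tendsto_one_div_add_atTop_nhds_zero_nat.mul_const x).neg)
    simpa using ENNReal.tendsto_ofReal h

/-- A finite measure on `[0, ∞)` is determined by its Laplace transform on the multiples of a
positive number. -/
lemma ext_of_laplace_eq {μ ν : Measure ℝ} [IsFiniteMeasure μ] [IsFiniteMeasure ν]
    (hμ : ∀ᵐ x ∂μ, 0 ≤ x) (hν : ∀ᵐ x ∂ν, 0 ≤ x) {c : ℝ} (hc : 0 < c)
    (h : ∀ k : ℕ, laplace μ (k * c) = laplace ν (k * c)) : μ = ν := by
  -- The exponential is bounded only on the half-line, hence the transfer to `NNReal`. Its powers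
  -- integrate to the given transform values, and the algebra it generates separates points.
  let g : BoundedContinuousFunction NNReal ℝ :=
    BoundedContinuousFunction.ofNormedAddCommGroup (fun x : NNReal => Real.exp (-(c * x)))
      (by fun_prop) 1 (fun x => by
        rw [Real.norm_eq_abs, abs_of_pos (Real.exp_pos _), Real.exp_le_one_iff]
        have := mul_nonneg hc.le x.2
        simpa using this)
  have hgx (x : NNReal) : g x = Real.exp (-(c * x)) := rfl
  let A : StarSubalgebra ℝ (BoundedContinuousFunction NNReal ℝ) :=
    { Algebra.adjoin ℝ {g} with
      star_mem' := fun {a} ha => by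
        have : star a = a := by ext x; simp
        rwa [this] }
  have hpow (ρ : Measure ℝ) (hρ : ∀ᵐ x ∂ρ, 0 ≤ x) (k : ℕ) :
      ∫ x, (g ^ k) x ∂(ρ.map Real.toNNReal) = (laplace ρ (k * c)).toReal := by
    rw [integral_map (by fun_prop) ((g ^ k).continuous.aestronglyMeasurable),
      integral_eq_lintegral_of_nonneg_ae, laplace]
    · congr 1
      refine lintegral_congr_ae ?_
      filter_upwards [hρ] with x hx
      simp only [BoundedContinuousFunction.pow_apply, hgx]
      rw [← Real.exp_nat_mul, Real.coe_toNNReal _ hx]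
      congr 2; ring
    · refine ae_of_all _ fun x => ?_
      simp only [BoundedContinuousFunction.pow_apply, hgx]
      positivity
    · exact ((g ^ k).continuous.comp continuous_real_toNNReal).aestronglyMeasurable
  have key : μ.map Real.toNNReal = ν.map Real.toNNReal := by
    refine ext_of_forall_mem_subalgebra_integral_eq_of_polish (𝕜 := ℝ) (A := A) ?_ ?_
    · intro x y hxy
      refine ⟨_, ⟨_, ⟨g, Algebra.subset_adjoin rfl, rfl⟩, rfl⟩, ?_⟩
      intro he
      apply hxy
      have he' : Real.exp (-(c * x)) = Real.exp (-(c * y)) := he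
      have := Real.exp_injective he'
      have h3 : (x : ℝ) = y := by
        have : c * (x : ℝ) = c * y := by linarith
        exact mul_left_cancel₀ hc.ne' this
      exact_mod_cast h3
    · intro f hf
      have hf' : f ∈ Algebra.adjoin ℝ {g} := hf
      rw [Algebra.adjoin_singleton_eq_range_aeval] at hf'
      obtain ⟨p, rfl⟩ := hf'
      induction p using Polynomial.induction_on' with
      | add p q hp hq =>
        have hp' := hp (by
          show _ ∈ Algebra.adjoin ℝ {g}
          rw [Algebra.adjoin_singleton_eq_range_aeval]; exact ⟨p, rfl⟩)
        have hq' := hq (by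
          show _ ∈ Algebra.adjoin ℝ {g}
          rw [Algebra.adjoin_singleton_eq_range_aeval]; exact ⟨q, rfl⟩)
        simp only [map_add, BoundedContinuousFunction.coe_add, Pi.add_apply]
        rw [integral_add (BoundedContinuousFunction.integrable _ _)
          (BoundedContinuousFunction.integrable _ _), integral_add
          (BoundedContinuousFunction.integrable _ _) (BoundedContinuousFunction.integrable _ _)]
        exact congrArg₂ _ hp' hq'
      | monomial n a =>
        have e : ∀ x, (Polynomial.aeval g ((Polynomial.monomial n) a)) x = a * (g ^ n) x := by
          intro x
          rw [Polynomial.aeval_monomial, ← Algebra.smul_def]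
          rfl
        change ∫ x, (Polynomial.aeval g ((Polynomial.monomial n) a)) x ∂_ =
          ∫ x, (Polynomial.aeval g ((Polynomial.monomial n) a)) x ∂_
        simp only [e, integral_const_mul, hpow μ hμ, hpow ν hν, h]
  have back (ρ : Measure ℝ) (hρ : ∀ᵐ x ∂ρ, 0 ≤ x) :
      (ρ.map Real.toNNReal).map (fun x : NNReal => (x : ℝ)) = ρ := by
    rw [Measure.map_map (by fun_prop) (by fun_prop)]
    conv_rhs => rw [← Measure.map_id (μ := ρ)]
    refine Measure.map_congr ?_
    filter_upwards [hρ] with x hx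
    simp [Real.coe_toNNReal x hx]
  rw [← back μ hμ, ← back ν hν, key]

/-! ### Equilibrium measures. -/

/-- The (unnormalised) equilibrium measure of `μ`: the measure on `(0, ∞)` with density
`x ↦ μ (x, ∞)`, constructed as the law of a uniform fraction of a size-biased variable. -/
def equilibrium (μ : Measure ℝ) : Measure ℝ :=
  ((μ.withDensity ENNReal.ofReal).prod (volume.restrict (Icc (0 : ℝ) 1))).map
    fun p => p.2 * p.1

instance (μ : Measure ℝ) [SFinite μ] : SFinite (equilibrium μ) := by
  unfold equilibrium; infer_instance

lemma lintegral_equilibrium (μ : Measure ℝ) [SFinite μ] {f : ℝ → ℝ≥0∞} (hf : Measurable f) :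
    ∫⁻ y, f y ∂equilibrium μ =
      ∫⁻ x, (ENNReal.ofReal x * ∫⁻ u in Icc (0 : ℝ) 1, f (u * x)) ∂μ := by
  have hm : Measurable fun p : ℝ × ℝ => f (p.2 * p.1) := hf.comp (by fun_prop)
  rw [equilibrium, lintegral_map hf (by fun_prop), lintegral_prod _ (by fun_prop),
    lintegral_withDensity_eq_lintegral_mul _ (by fun_prop) (Measurable.lintegral_prod_right' hm)]
  rfl

lemma ae_nonneg_equilibrium (μ : Measure ℝ) [SFinite μ] :
    ∀ᵐ x ∂equilibrium μ, 0 ≤ x := by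
  have hs : MeasurableSet {x : ℝ | ¬ 0 ≤ x} := measurableSet_Ici.compl
  rw [ae_iff, ← lintegral_indicator_one hs, lintegral_equilibrium _ (measurable_one.indicator hs),
    lintegral_eq_zero_iff']
  · refine ae_of_all _ fun x => ?_
    rcases le_total x 0 with hx | hx
    · simp [ENNReal.ofReal_of_nonpos hx]
    · have : ∫⁻ u in Icc (0 : ℝ) 1, ({x : ℝ | ¬ 0 ≤ x}.indicator 1 (u * x) : ℝ≥0∞) = 0 := by
        rw [setLIntegral_congr_fun (g := 0) measurableSet_Icc, Pi.zero_def, lintegral_zero]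
        intro u hu
        simp [mul_nonneg hu.1 hx]
      exact mul_eq_zero_of_right _ this
  · have hm : Measurable fun p : ℝ × ℝ => ({x : ℝ | ¬ 0 ≤ x}.indicator 1 (p.2 * p.1) : ℝ≥0∞) :=
      (measurable_one.indicator hs).comp (by fun_prop)
    exact (ENNReal.measurable_ofReal.mul (Measurable.lintegral_prod_right' hm)).aemeasurable

/-- Size-biasing supplies one extra factor `x`, and the uniform fraction splits off as a constant.
This shift by one is why `k` moments of the delay cost `k + 1` moments of the service time. -/
lemma posMoment_equilibrium (μ : Measure ℝ) [SFinite μ] (k : ℕ) :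
    posMoment (equilibrium μ) k =
      posMoment μ (k + 1) * ∫⁻ u in Icc (0 : ℝ) 1, ENNReal.ofReal u ^ k := by
  rw [posMoment, lintegral_equilibrium _ (by fun_prop), posMoment, ← lintegral_mul_const _ (by fun_prop)]
  refine lintegral_congr fun x => ?_
  have : ∫⁻ u in Icc (0 : ℝ) 1, ENNReal.ofReal (u * x) ^ k =
      ENNReal.ofReal x ^ k * ∫⁻ u in Icc (0 : ℝ) 1, ENNReal.ofReal u ^ k := by
    rw [← lintegral_const_mul _ (by fun_prop)]
    refine setLIntegral_congr_fun measurableSet_Icc fun u hu => ?_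
    rw [ENNReal.ofReal_mul hu.1, mul_pow, mul_comm]
  rw [this]
  ring

lemma equilibrium_univ (μ : Measure ℝ) [SFinite μ] : equilibrium μ univ = posMoment μ 1 := by
  rw [← posMoment_zero, posMoment_equilibrium]
  simp

lemma lintegral_unitInterval_pow_ne_top (k : ℕ) :
    ∫⁻ u in Icc (0 : ℝ) 1, ENNReal.ofReal u ^ k ≠ ∞ := by
  refine ne_top_of_le_ne_top ENNReal.one_ne_top ?_
  calc ∫⁻ u in Icc (0 : ℝ) 1, ENNReal.ofReal u ^ k ≤ ∫⁻ _u in Icc (0 : ℝ) 1, 1 := by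
        refine setLIntegral_mono measurable_const fun u hu => ?_
        exact pow_le_one₀ zero_le (ENNReal.ofReal_le_one.mpr hu.2)
    _ = 1 := by simp

lemma lintegral_unitInterval_pow_ne_zero (k : ℕ) :
    ∫⁻ u in Icc (0 : ℝ) 1, ENNReal.ofReal u ^ k ≠ 0 := by
  refine (lt_of_lt_of_le ?_ (lintegral_mono_set (s := Icc (1 / 2 : ℝ) 1) (μ := volume)
    (f := fun u => ENNReal.ofReal u ^ k)
    (Icc_subset_Icc_left (by norm_num : (0 : ℝ) ≤ 1 / 2)))).ne'
  refine lt_of_lt_of_le ?_ (setLIntegral_mono (f := fun _ => ENNReal.ofReal (1 / 2) ^ k)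
    (by fun_prop) fun u hu => ?_)
  · simp only [lintegral_const, Measure.restrict_apply MeasurableSet.univ, univ_inter,
      Real.volume_Icc]
    refine ENNReal.mul_pos (pow_ne_zero _ ?_) ?_ <;> norm_num
  · gcongr
    exact hu.1

lemma posMoment_equilibrium_lt_top_iff (μ : Measure ℝ) [SFinite μ] (k : ℕ) :
    posMoment (equilibrium μ) k < ∞ ↔ posMoment μ (k + 1) < ∞ := by
  rw [posMoment_equilibrium]
  refine ⟨fun h => ?_, fun h => ENNReal.mul_lt_top h
    (lintegral_unitInterval_pow_ne_top k).lt_top⟩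
  exact ENNReal.lt_top_of_mul_ne_top_left h.ne (lintegral_unitInterval_pow_ne_zero k)

lemma exp_add_mul_lintegral_exp {s x : ℝ} (hs : 0 < s) (hx : 0 ≤ x) :
    ENNReal.ofReal (Real.exp (-(s * x))) + ENNReal.ofReal s *
      (ENNReal.ofReal x * ∫⁻ u in Icc (0 : ℝ) 1, ENNReal.ofReal (Real.exp (-(s * (u * x))))) = 1 := by
  have hi : ∫ u in (0 : ℝ)..1, s * x * Real.exp (-(s * (u * x))) = 1 - Real.exp (-(s * x)) := by
    have hd : ∀ u ∈ uIcc (0 : ℝ) 1, HasDerivAt (fun u => -Real.exp (-(s * (u * x))))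
        (s * x * Real.exp (-(s * (u * x)))) u := by
      intro u _
      have := (((((hasDerivAt_id u).mul_const x).const_mul s).neg).exp).neg
      refine HasDerivAt.congr_deriv (f := fun u => -Real.exp (-(s * (u * x)))) this ?_
      simp only [Pi.neg_apply, id]
      ring
    rw [intervalIntegral.integral_eq_sub_of_hasDerivAt hd
      (Continuous.intervalIntegrable (by fun_prop) _ _)]
    simp; ring
  have hsx : 0 ≤ s * x := mul_nonneg hs.le hx
  rw [← mul_assoc, ← ENNReal.ofReal_mul hs.le, ← lintegral_const_mul _ (by fun_prop)]
  have hpt : ∀ u : ℝ, ENNReal.ofReal (s * x) * ENNReal.ofReal (Real.exp (-(s * (u * x)))) =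
      ENNReal.ofReal (s * x * Real.exp (-(s * (u * x)))) := fun u => (ENNReal.ofReal_mul hsx).symm
  simp only [hpt]
  rw [← ofReal_integral_eq_lintegral_ofReal
      (Continuous.integrableOn_Icc (by fun_prop)) (ae_of_all _ fun u => by positivity),
    integral_Icc_eq_integral_Ioc, ← intervalIntegral.integral_of_le zero_le_one, hi,
    ← ENNReal.ofReal_add (Real.exp_pos _).le]
  · simp
  · have : Real.exp (-(s * x)) ≤ 1 := Real.exp_le_one_iff.mpr (by linarith)
    linarith

/-- Integration by parts, `1 - μ̂ = s μ̂_e` for a probability measure, kept in additive form so that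
no truncated subtraction occurs. -/
lemma laplace_add_mul_laplace_equilibrium {μ : Measure ℝ} [SFinite μ] (hμ : ∀ᵐ x ∂μ, 0 ≤ x)
    {s : ℝ} (hs : 0 < s) :
    laplace μ s + ENNReal.ofReal s * laplace (equilibrium μ) s = μ univ := by
  have hm : Measurable fun p : ℝ × ℝ => ENNReal.ofReal (Real.exp (-(s * (p.2 * p.1)))) := by
    fun_prop
  have hm' : Measurable fun x => ENNReal.ofReal x * ∫⁻ u in Icc (0 : ℝ) 1,
      ENNReal.ofReal (Real.exp (-(s * (u * x)))) := ENNReal.measurable_ofReal.mul (Measurable.lintegral_prod_right'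
    (ν := volume.restrict (Icc (0 : ℝ) 1)) hm)
  rw [laplace, laplace, lintegral_equilibrium _ (by fun_prop),
    ← lintegral_const_mul _ hm', ← lintegral_add_left (by fun_prop), ← lintegral_one]
  refine lintegral_congr_ae ?_
  filter_upwards [hμ] with x hx using exp_add_mul_lintegral_exp hs hx

/-! ### A summability criterion. -/

/-- A recursive inequality with ratio less than `1` and a summable inhomogeneity has only summable
solutions. -/
lemma tsum_lt_top_of_le_mul_add {q : ℝ≥0∞} (hq : q < 1) {a b : ℕ → ℝ≥0∞} (h0 : a 0 < ∞)
    (hb : ∑' n, b n < ∞) (h : ∀ n, a (n + 1) ≤ q * a n + b n) : ∑' n, a n < ∞ := by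
  set K := a 0 + ∑' n, b n with hK
  have hq' : 1 - q ≠ 0 := (tsub_pos_of_lt hq).ne'
  have hqt : 1 - q ≠ ∞ := ne_top_of_le_ne_top ENNReal.one_ne_top tsub_le_self
  have hle : ∑' n, a n ≤ K / (1 - q) := by
    -- Induction on partial sums: `K / (1 - q)` is the fixed point of `x ↦ q x + K`.
    refine ENNReal.tsum_le_of_sum_range_le fun n => ?_
    induction n with
    | zero => simp
    | succ n ih =>
      rw [Finset.sum_range_succ']
      calc ∑ k ∈ Finset.range n, a (k + 1) + a 0
          ≤ ∑ k ∈ Finset.range n, (q * a k + b k) + a 0 := by gcongr; exact h _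
        _ = q * ∑ k ∈ Finset.range n, a k + (∑ k ∈ Finset.range n, b k + a 0) := by
            rw [Finset.sum_add_distrib, Finset.mul_sum, add_assoc]
        _ ≤ q * (K / (1 - q)) + K := by
            gcongr
            rw [hK, add_comm]
            gcongr
            exact ENNReal.sum_le_tsum _
        _ = q * (K / (1 - q)) + (1 - q) * (K / (1 - q)) := by
            rw [ENNReal.mul_div_cancel hq' hqt]
        _ = K / (1 - q) := by rw [← add_mul, add_tsub_cancel_of_le hq.le, one_mul]
  exact hle.trans_lt (ENNReal.div_lt_top (ENNReal.add_lt_top.mpr ⟨h0, hb⟩).ne hq')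

/-! ### Vacations and the residual vacation. -/

lemma measurable_vacationEnd :
    Measurable fun p : (ℕ → ℝ) × ℝ => vacationEnd p.1 p.2 := by
  have hS (n : ℕ) : MeasurableSet {p : (ℕ → ℝ) × ℝ | p.2 ≤ ∑ k ∈ Finset.range n, p.1 k} :=
    measurableSet_le (by fun_prop) (by fun_prop)
  have hN : Measurable fun p : (ℕ → ℝ) × ℝ =>
      sInf {n : ℕ | p.2 ≤ ∑ k ∈ Finset.range n, p.1 k} := by
    refine measurable_to_countable' fun n => ?_
    -- The second set of the union accounts for `sInf ∅ = 0`, when the vacations never reach the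
    -- given time.
    have : (fun p : (ℕ → ℝ) × ℝ => sInf {n : ℕ | p.2 ≤ ∑ k ∈ Finset.range n, p.1 k}) ⁻¹' {n} =
        ({p | p.2 ≤ ∑ k ∈ Finset.range n, p.1 k} ∩
          ⋂ m ∈ Finset.range n, {p | p.2 ≤ ∑ k ∈ Finset.range m, p.1 k}ᶜ) ∪
        ({p | n = 0} ∩ ⋂ m : ℕ, {p | p.2 ≤ ∑ k ∈ Finset.range m, p.1 k}ᶜ) := by
      ext p
      simp only [mem_preimage, mem_singleton_iff, mem_union, mem_inter_iff, mem_ofPred_eq,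
        mem_iInter, mem_compl_iff, Finset.mem_range]
      constructor
      · rintro rfl
        rcases eq_empty_or_nonempty {n : ℕ | p.2 ≤ ∑ k ∈ Finset.range n, p.1 k} with he | he
        · refine Or.inr ⟨by rw [he, Nat.sInf_empty], fun m hm => ?_⟩
          have : m ∈ {n : ℕ | p.2 ≤ ∑ k ∈ Finset.range n, p.1 k} := hm
          simp [he] at this
        · exact Or.inl ⟨Nat.sInf_mem he, fun m hm => Nat.notMem_of_lt_sInf hm⟩
      · rintro (⟨h1, h2⟩ | ⟨rfl, h⟩)
        · refine le_antisymm (Nat.sInf_le h1) ?_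
          by_contra hlt
          exact h2 _ (not_le.mp hlt)
            (Nat.sInf_mem (s := {n : ℕ | p.2 ≤ ∑ k ∈ Finset.range n, p.1 k}) ⟨n, h1⟩)
        · rw [Nat.sInf_eq_zero]
          exact Or.inr (eq_empty_of_forall_notMem h)
    rw [this]
    exact ((hS n).inter (Finset.measurableSet_biInter _ fun m _ => (hS m).compl)).union
      ((MeasurableSet.const _).inter (MeasurableSet.iInter fun m => (hS m).compl))
  have hF : Measurable fun q : ℕ × ((ℕ → ℝ) × ℝ) => ∑ k ∈ Finset.range q.1, q.2.1 k :=
    measurable_from_prod_countable_right fun n => by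
      show Measurable fun x : (ℕ → ℝ) × ℝ => ∑ k ∈ Finset.range n, x.1 k
      fun_prop
  exact hF.comp (hN.prodMk measurable_id)

/-- The end of the vacation in progress is at most one vacation away. -/
lemma vacationEnd_sub_mem_Icc {v : ℕ → ℝ} {a B u : ℝ} (ha : 0 < a) (hv : ∀ k, v k ∈ Icc a B)
    (hu : 0 ≤ u) : vacationEnd v u - u ∈ Icc 0 B := by
  -- Vacations bounded below by `a > 0` eventually pass `u`, so the infimum is attained and is not
  -- the default value.
  have hne : {n : ℕ | u ≤ ∑ k ∈ Finset.range n, v k}.Nonempty := by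
    obtain ⟨n, hn⟩ := exists_nat_ge (u / a)
    refine ⟨n, ?_⟩
    have h1 : ∑ _k ∈ Finset.range n, a ≤ ∑ k ∈ Finset.range n, v k :=
      Finset.sum_le_sum fun k _ => (hv k).1
    rw [Finset.sum_const, Finset.card_range, nsmul_eq_mul] at h1
    rw [div_le_iff₀ ha] at hn
    exact hn.trans h1
  have hmem := Nat.sInf_mem hne
  have hB : 0 ≤ B := ha.le.trans ((hv 0).1.trans (hv 0).2)
  unfold vacationEnd
  refine ⟨sub_nonneg.mpr hmem, ?_⟩
  rcases h : sInf {n : ℕ | u ≤ ∑ k ∈ Finset.range n, v k} with _ | m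
  · simp; linarith
  · have hlt : m ∉ {n : ℕ | u ≤ ∑ k ∈ Finset.range n, v k} :=
      Nat.notMem_of_lt_sInf (by rw [h]; exact Nat.lt_succ_self m)
    have hlt' : ∑ k ∈ Finset.range m, v k < u := not_le.mp hlt
    rw [Finset.sum_range_succ]
    linarith [(hv m).2]

lemma measurable_nextDelay :
    Measurable fun ω : ℝ × ℝ × ℝ × (ℕ → ℝ) => nextDelay ω.1 ω.2.1 ω.2.2.1 ω.2.2.2 := by
  unfold nextDelay
  have h := measurable_vacationEnd.comp
    (show Measurable fun ω : ℝ × ℝ × ℝ × (ℕ → ℝ) => (ω.2.2.2, ω.2.1 - ω.1) by fun_prop)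
  refine Measurable.sub (Measurable.add (Measurable.ite
    (measurableSet_le (by fun_prop) (by fun_prop)) (by fun_prop) ?_) (by fun_prop)) (by fun_prop)
  exact measurable_fst.add h

/-- The law of the remaining vacation time at the arrival of the first packet to an empty queue. -/
def residualLaw (lam : ℝ) (V : Measure (ℕ → ℝ)) : Measure ℝ :=
  ((expMeasure lam).prod V).map fun p => vacationEnd p.2 p.1 - p.1

lemma measurable_residual :
    Measurable fun p : ℝ × (ℕ → ℝ) => vacationEnd p.2 p.1 - p.1 :=
  (measurable_vacationEnd.comp measurable_swap).sub measurable_fst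

lemma isProbabilityMeasure_residualLaw {lam : ℝ} (hl : 0 < lam) (V : Measure (ℕ → ℝ))
    [IsProbabilityMeasure V] : IsProbabilityMeasure (residualLaw lam V) :=
  have := isProbabilityMeasure_expMeasure hl
  Measure.isProbabilityMeasure_map measurable_residual.aemeasurable

lemma expMeasure_eq (lam : ℝ) : expMeasure lam = volume.withDensity (exponentialPDF lam) := rfl

lemma measurable_exponentialPDF (lam : ℝ) : Measurable (exponentialPDF lam) :=
  (measurable_exponentialPDFReal lam).ennreal_ofReal

lemma ae_nonneg_expMeasure (lam : ℝ) : ∀ᵐ t ∂expMeasure lam, 0 ≤ t := by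
  rw [expMeasure_eq, ae_withDensity_iff (measurable_exponentialPDF lam)]
  refine ae_of_all _ fun t ht => ?_
  by_contra h
  exact ht (exponentialPDF_of_neg (not_le.mp h))

/-- Boundedness gives the residual vacation all moments, so vacations never affect the finiteness of
delay moments. -/
lemma ae_residualLaw_mem_Icc {lam a B : ℝ} (hl : 0 < lam) {V : Measure (ℕ → ℝ)}
    [IsProbabilityMeasure V] (ha : 0 < a) (hV : ∀ᵐ v ∂V, ∀ k, v k ∈ Icc a B) :
    ∀ᵐ x ∂residualLaw lam V, x ∈ Icc 0 B := by
  have := isProbabilityMeasure_expMeasure hl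
  rw [residualLaw, ae_map_iff (p := fun x => x ∈ Icc 0 B) measurable_residual.aemeasurable
    measurableSet_Icc]
  have h1 : ∀ᵐ p ∂(expMeasure lam).prod V, 0 ≤ p.1 :=
    Measure.quasiMeasurePreserving_fst.ae (ae_nonneg_expMeasure lam)
  have h2 : ∀ᵐ p ∂(expMeasure lam).prod V, ∀ k, p.2 k ∈ Icc a B :=
    Measure.quasiMeasurePreserving_snd.ae hV
  filter_upwards [h1, h2] with p h1 h2 using vacationEnd_sub_mem_Icc ha h2 h1

/-! ### One step of the delay recursion. -/

/-- The memoryless property of the exponential law. -/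
lemma lintegral_expMeasure_ite {lam d : ℝ} (hd : 0 ≤ d) {f g : ℝ → ℝ≥0∞}
    (hf : Measurable f) (hg : Measurable g) :
    ∫⁻ t, (if t ≤ d then f t else g (t - d)) ∂expMeasure lam =
      (∫⁻ t in Icc 0 d, ENNReal.ofReal (lam * Real.exp (-(lam * t))) * f t) +
        ENNReal.ofReal (Real.exp (-(lam * d))) * ∫⁻ t, g t ∂expMeasure lam := by
  have hgd : Measurable fun t => g (t - d) := hg.comp (by fun_prop)
  have hp := measurable_exponentialPDF lam
  rw [expMeasure_eq, lintegral_withDensity_eq_lintegral_mul _ hp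
      (Measurable.ite measurableSet_Iic hf hgd),
    lintegral_withDensity_eq_lintegral_mul _ hp hg,
    ← lintegral_add_compl _ (measurableSet_Iic (a := d))]
  congr 1
  · rw [← lintegral_indicator measurableSet_Iic, ← lintegral_indicator measurableSet_Icc]
    refine lintegral_congr fun t => ?_
    by_cases h0 : 0 ≤ t
    · by_cases h1 : t ≤ d
      · simp [indicator, h0, h1, exponentialPDF_of_nonneg h0]
      · simp [indicator, h1]
    · simp [indicator, h0, exponentialPDF_of_neg (not_le.mp h0)]
  · rw [← lintegral_indicator measurableSet_Iic.compl,
      ← lintegral_add_right_eq_self _ d, ← lintegral_const_mul _ (hp.mul hg)]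
    -- The two integrands may differ at `0`: the density is positive there, but the shifted point
    -- `d` belongs to the other half of the split.
    have h0 : ∀ᵐ t : ℝ, t ≠ 0 := by simp [ae_iff]
    refine lintegral_congr_ae ?_
    filter_upwards [h0] with t ht
    rcases lt_or_gt_of_ne ht with h | h
    · have : t + d ≤ d := by linarith
      simp [indicator, not_lt.mpr h.le, exponentialPDF_of_neg h]
    · have h1 : ¬ t + d ≤ d := by linarith
      have h2 : t + d ∈ (Iic d)ᶜ := h1
      rw [indicator_of_mem h2, Pi.mul_apply, Pi.mul_apply, if_neg h1, add_sub_cancel_right,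
        exponentialPDF_of_nonneg (by linarith), exponentialPDF_of_nonneg h.le, ← mul_assoc,
        ← ENNReal.ofReal_mul (Real.exp_pos _).le]
      congr 2
      rw [show -(lam * (t + d)) = -(lam * d) + -(lam * t) by ring, Real.exp_add]
      ring

/-- `E[exp (-s (d - T)); T ≤ d]` for an exponential time `T`. -/
def busyLaplace (lam s d : ℝ) : ℝ≥0∞ :=
  ∫⁻ t in Icc 0 d, ENNReal.ofReal (lam * Real.exp (-(lam * t))) *
    ENNReal.ofReal (Real.exp (-(s * (d - t))))

lemma busyLaplace_le_one {lam s d : ℝ} (hl : 0 < lam) (hs : 0 < s) (hd : 0 ≤ d) :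
    busyLaplace lam s d ≤ 1 := by
  have := isProbabilityMeasure_expMeasure hl
  have h := lintegral_expMeasure_ite (lam := lam) hd (f := 1) (g := 1) measurable_one measurable_one
  simp only [Pi.one_apply, ite_self, lintegral_one, measure_univ, mul_one] at h
  rw [h]
  refine le_trans ?_ le_self_add
  refine setLIntegral_mono (by fun_prop) fun t ht => ?_
  refine mul_le_of_le_one_right' ?_
  rw [ENNReal.ofReal_le_one, Real.exp_le_one_iff]
  nlinarith [ht.2]

/-- This is `(λ - s) A = λ (e^{-sd} - e^{-λd})` with the negative terms moved across, `A` being the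
busy part. -/
lemma busyLaplace_identity {lam s d : ℝ} (hl : 0 < lam) (hs : 0 < s) (hd : 0 ≤ d) :
    ENNReal.ofReal lam * busyLaplace lam s d +
        ENNReal.ofReal lam * ENNReal.ofReal (Real.exp (-(lam * d))) =
      ENNReal.ofReal s * busyLaplace lam s d +
        ENNReal.ofReal lam * ENNReal.ofReal (Real.exp (-(s * d))) := by
  set I := ∫ t in (0 : ℝ)..d, lam * Real.exp (-(lam * t)) * Real.exp (-(s * (d - t))) with hI
  have hA : busyLaplace lam s d = ENNReal.ofReal I := by
    rw [busyLaplace, hI, intervalIntegral.integral_of_le hd, ← integral_Icc_eq_integral_Ioc,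
      ofReal_integral_eq_lintegral_ofReal (Continuous.integrableOn_Icc (by fun_prop))
        (ae_of_all _ fun u => by positivity)]
    refine lintegral_congr fun t => ?_
    rw [← ENNReal.ofReal_mul (by positivity)]
  have hI0 : 0 ≤ I := intervalIntegral.integral_nonneg hd fun t _ => by positivity
  have hi : (lam - s) * I = lam * Real.exp (-(s * d)) - lam * Real.exp (-(lam * d)) := by
    -- An antiderivative of `λ - s` times the integrand: nothing is divided by `λ - s`, so `s = λ`
    -- needs no separate case.
    have hder : ∀ t ∈ uIcc (0 : ℝ) d,
        HasDerivAt (fun t => -(lam * Real.exp (-(lam * t) + -(s * (d - t)))))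
          ((lam - s) * (lam * Real.exp (-(lam * t)) * Real.exp (-(s * (d - t))))) t := by
      intro t _
      have h1 : HasDerivAt (fun t => -(lam * t) + -(s * (d - t))) (-lam + s) t := by
        have := (((hasDerivAt_id t).const_mul lam).neg).add
          ((((hasDerivAt_id t).const_sub d).const_mul s).neg)
        refine HasDerivAt.congr_deriv (f := fun t => -(lam * t) + -(s * (d - t))) this ?_
        ring
      refine HasDerivAt.congr_deriv
        (f := fun t => -(lam * Real.exp (-(lam * t) + -(s * (d - t))))) (h1.exp.const_mul lam).neg ?_
      rw [Real.exp_add]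
      ring
    rw [hI, ← intervalIntegral.integral_const_mul,
      intervalIntegral.integral_eq_sub_of_hasDerivAt hder
        (Continuous.intervalIntegrable (by fun_prop) _ _)]
    simp
    ring
  rw [hA, ← ENNReal.ofReal_mul hl.le, ← ENNReal.ofReal_mul hl.le, ← ENNReal.ofReal_mul hl.le,
    ← ENNReal.ofReal_mul hs.le, ← ENNReal.ofReal_add (by positivity) (by positivity),
    ← ENNReal.ofReal_add (by positivity) (by positivity)]
  congr 1
  linarith

lemma measurable_busyLaplace (lam s : ℝ) : Measurable (busyLaplace lam s) := by
  have : busyLaplace lam s = fun d => ∫⁻ t, (if 0 ≤ t ∧ t ≤ d then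
      ENNReal.ofReal (lam * Real.exp (-(lam * t))) * ENNReal.ofReal (Real.exp (-(s * (d - t))))
      else 0) := by
    ext d
    rw [busyLaplace, ← lintegral_indicator measurableSet_Icc]
    refine lintegral_congr fun t => ?_
    simp [indicator]
  rw [this]
  refine Measurable.lintegral_prod_right' (f := fun p : ℝ × ℝ => if 0 ≤ p.2 ∧ p.2 ≤ p.1 then
      ENNReal.ofReal (lam * Real.exp (-(lam * p.2))) *
        ENNReal.ofReal (Real.exp (-(s * (p.1 - p.2)))) else 0) ?_
  have h1 : MeasurableSet {p : ℝ × ℝ | 0 ≤ p.2} := measurableSet_le (by fun_prop) (by fun_prop)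
  have h2 : MeasurableSet {p : ℝ × ℝ | p.2 ≤ p.1} := measurableSet_le (by fun_prop) (by fun_prop)
  have h3 : MeasurableSet {p : ℝ × ℝ | 0 ≤ p.2 ∧ p.2 ≤ p.1} := by
    have h12 := h1.inter h2
    rwa [show {p : ℝ × ℝ | 0 ≤ p.2} ∩ {p | p.2 ≤ p.1} = {p | 0 ≤ p.2 ∧ p.2 ≤ p.1} by
      ext; simp] at h12
  exact Measurable.ite h3 (by fun_prop) measurable_const

/-- The law of the delay of a packet when that of the preceding one is `μ`, for arrival rate `lam`,
service law `X` and law `V` of the sequence of vacations. -/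
def nextDelayLaw (lam : ℝ) (X : Measure ℝ) (V : Measure (ℕ → ℝ)) (μ : Measure ℝ) : Measure ℝ :=
  (μ.prod ((expMeasure lam).prod (X.prod V))).map
    fun ω => nextDelay ω.1 ω.2.1 ω.2.2.1 ω.2.2.2

/-- Either the packet arrives during the preceding delay and waits for what is left of it, or it
finds the queue empty. In the latter case the excess of the interarrival time over the delay is
again exponential and independent of the delay, which yields the residual vacation weighted by
`laplace μ lam`, the probability of an empty queue. -/
lemma laplace_nextDelayLaw {lam s : ℝ} (hl : 0 < lam) (X : Measure ℝ) [SFinite X]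
    (V : Measure (ℕ → ℝ)) [IsProbabilityMeasure V] (μ : Measure ℝ)
    (hμ : ∀ᵐ d ∂μ, 0 ≤ d) :
    laplace (nextDelayLaw lam X V μ) s = laplace X s *
      ((∫⁻ d, busyLaplace lam s d ∂μ) + laplace μ lam * laplace (residualLaw lam V) s) := by
  have := isProbabilityMeasure_expMeasure hl
  set G : ℝ → ℝ≥0∞ := fun u => ∫⁻ v, ENNReal.ofReal (Real.exp (-(s * (vacationEnd v u - u)))) ∂V
  have hr : Measurable fun p : ℝ × (ℕ → ℝ) =>
      ENNReal.ofReal (Real.exp (-(s * (vacationEnd p.2 p.1 - p.1)))) :=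
    ENNReal.measurable_ofReal.comp (Real.measurable_exp.comp
      ((measurable_residual.const_mul s).neg))
  have hGm : Measurable G := Measurable.lintegral_prod_right' hr
  have hR : laplace (residualLaw lam V) s = ∫⁻ t, G t ∂expMeasure lam := by
    rw [laplace, residualLaw, lintegral_map (by fun_prop) measurable_residual,
      lintegral_prod _ hr.aemeasurable]
  have hm : Measurable fun ω : ℝ × ℝ × ℝ × (ℕ → ℝ) =>
      ENNReal.ofReal (Real.exp (-(s * nextDelay ω.1 ω.2.1 ω.2.2.1 ω.2.2.2))) :=
    ENNReal.measurable_ofReal.comp (Real.measurable_exp.comp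
      ((measurable_nextDelay.const_mul s).neg))
  have hinner (d t : ℝ) :
      ∫⁻ q : ℝ × (ℕ → ℝ), ENNReal.ofReal (Real.exp (-(s * nextDelay d t q.1 q.2))) ∂X.prod V =
        laplace X s * (if t ≤ d then ENNReal.ofReal (Real.exp (-(s * (d - t)))) else G (t - d)) := by
    have hm' : Measurable fun q : ℝ × (ℕ → ℝ) =>
        ENNReal.ofReal (Real.exp (-(s * nextDelay d t q.1 q.2))) := by
      have h := hm.comp (show Measurable fun q : ℝ × (ℕ → ℝ) => (d, t, q.1, q.2) by fun_prop)
      simpa only [Function.comp_def] using h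
    rw [lintegral_prod _ hm'.aemeasurable, laplace, ← lintegral_mul_const _ (by fun_prop)]
    refine lintegral_congr fun x => ?_
    split_ifs with h
    · have e : ∀ v, -(s * nextDelay d t x v) = -(s * x) + -(s * (d - t)) := fun v => by
        simp only [nextDelay, if_pos h]; ring
      simp only [e, Real.exp_add, ENNReal.ofReal_mul (Real.exp_pos _).le, lintegral_const,
        measure_univ, mul_one]
    · have e : ∀ v, -(s * nextDelay d t x v) =
          -(s * x) + -(s * (vacationEnd v (t - d) - (t - d))) := fun v => by
        simp only [nextDelay, if_neg h]; ring
      simp only [e, Real.exp_add, ENNReal.ofReal_mul (Real.exp_pos _).le]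
      have hrt : Measurable fun v =>
          ENNReal.ofReal (Real.exp (-(s * (vacationEnd v (t - d) - (t - d))))) := by
        have h := hr.comp (measurable_prodMk_left (x := t - d))
        simpa only [Function.comp_def] using h
      rw [lintegral_const_mul _ hrt]
  have hmt (d : ℝ) : Measurable fun t =>
      if t ≤ d then ENNReal.ofReal (Real.exp (-(s * (d - t)))) else G (t - d) :=
    Measurable.ite measurableSet_Iic (by fun_prop) (hGm.comp (by fun_prop))
  have hmid : ∀ᵐ d ∂μ, ∫⁻ q : ℝ × ℝ × (ℕ → ℝ),
      ENNReal.ofReal (Real.exp (-(s * nextDelay d q.1 q.2.1 q.2.2)))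
        ∂(expMeasure lam).prod (X.prod V) = laplace X s * (busyLaplace lam s d +
          ENNReal.ofReal (Real.exp (-(lam * d))) * laplace (residualLaw lam V) s) := by
    filter_upwards [hμ] with d hd
    have hm' : Measurable fun q : ℝ × ℝ × (ℕ → ℝ) =>
        ENNReal.ofReal (Real.exp (-(s * nextDelay d q.1 q.2.1 q.2.2))) := by
      have h := hm.comp
        (show Measurable fun q : ℝ × ℝ × (ℕ → ℝ) => (d, q.1, q.2.1, q.2.2) by fun_prop)
      simpa only [Function.comp_def] using h
    rw [lintegral_prod _ hm'.aemeasurable]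
    simp only [hinner]
    rw [lintegral_const_mul _ (hmt d),
      lintegral_expMeasure_ite hd (f := fun t => ENNReal.ofReal (Real.exp (-(s * (d - t)))))
        (by fun_prop) hGm, hR]
    rfl
  have hb := measurable_busyLaplace lam s
  rw [laplace, nextDelayLaw, lintegral_map (by fun_prop) measurable_nextDelay,
    lintegral_prod _ hm.aemeasurable, lintegral_congr_ae hmid,
    lintegral_const_mul _ (by fun_prop), lintegral_add_left hb, lintegral_mul_const _ (by fun_prop)]
  rfl

/-! ### The renewal equation and uniqueness. -/

/-- Up to normalisation, the law of the sum of a service time and the wait for the end of a vacation;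
it is the inhomogeneous term of the renewal equation for the stationary delay law. -/
def seedLaw (lam : ℝ) (X : Measure ℝ) (V : Measure (ℕ → ℝ)) : Measure ℝ :=
  X.conv (ENNReal.ofReal lam • equilibrium (residualLaw lam V) + residualLaw lam V)

section Queue

variable {lam a B : ℝ} {X : Measure ℝ} {V : Measure (ℕ → ℝ)}

lemma laplace_ne_top {μ : Measure ℝ} [IsFiniteMeasure μ] (hμ : ∀ᵐ x ∂μ, 0 ≤ x) {s : ℝ}
    (hs : 0 ≤ s) : laplace μ s ≠ ∞ :=
  ((laplace_le_mass hμ hs).trans_lt (measure_lt_top μ univ)).ne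

/-- Finite even when the mean, and hence the mass of the equilibrium measure, is infinite:
multiplied by `s > 0` it is at most the mass of `μ`. -/
lemma laplace_equilibrium_ne_top {μ : Measure ℝ} [IsFiniteMeasure μ] (hμ : ∀ᵐ x ∂μ, 0 ≤ x) {s : ℝ}
    (hs : 0 < s) : laplace (equilibrium μ) s ≠ ∞ := by
  intro h
  have := laplace_add_mul_laplace_equilibrium hμ hs
  rw [h, ENNReal.mul_top (by simpa using hs), add_top] at this
  exact measure_ne_top μ univ this.symm

lemma laplace_seedLaw [SFinite X] [IsProbabilityMeasure V] (hl : 0 < lam) (s : ℝ) :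
    laplace (seedLaw lam X V) s = laplace X s * (ENNReal.ofReal lam *
      laplace (equilibrium (residualLaw lam V)) s + laplace (residualLaw lam V) s) := by
  have := isProbabilityMeasure_residualLaw hl V
  rw [seedLaw, laplace_conv, laplace_add, laplace_smul]

/-- The renewal equation satisfied by the Laplace transform of a stationary delay law. -/
lemma laplace_nextDelayLaw_eq_iff [IsProbabilityMeasure X] [IsProbabilityMeasure V] (hl : 0 < lam)
    (hX : ∀ᵐ x ∂X, 0 ≤ x) (hR : ∀ᵐ x ∂residualLaw lam V, 0 ≤ x)
    {μ : Measure ℝ} [IsProbabilityMeasure μ] (hμ : ∀ᵐ x ∂μ, 0 ≤ x) {s : ℝ} (hs : 0 < s)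
    (hsl : s ≠ lam) :
    laplace (nextDelayLaw lam X V μ) s = laplace μ s ↔
      laplace μ s = ENNReal.ofReal lam * laplace (equilibrium X) s * laplace μ s +
        laplace μ lam * laplace (seedLaw lam X V) s := by
  have := isProbabilityMeasure_residualLaw hl V
  rw [laplace_nextDelayLaw hl X V μ hμ, laplace_seedLaw hl]
  have hAle : ∫⁻ d, busyLaplace lam s d ∂μ ≤ 1 := by
    calc ∫⁻ d, busyLaplace lam s d ∂μ ≤ ∫⁻ _d, 1 ∂μ := lintegral_mono_ae <| by
          filter_upwards [hμ] with d hd using busyLaplace_le_one hl hs hd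
      _ = 1 := by simp
  have hA := congrArg ENNReal.toReal (show
      ENNReal.ofReal lam * (∫⁻ d, busyLaplace lam s d ∂μ) + ENNReal.ofReal lam * laplace μ lam =
      ENNReal.ofReal s * (∫⁻ d, busyLaplace lam s d ∂μ) + ENNReal.ofReal lam * laplace μ s by
    have hb := measurable_busyLaplace lam s
    rw [laplace, laplace, ← lintegral_const_mul _ hb, ← lintegral_const_mul _ (by fun_prop),
      ← lintegral_const_mul _ hb, ← lintegral_const_mul _ (by fun_prop),
      ← lintegral_add_left (by fun_prop), ← lintegral_add_left (by fun_prop)]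
    refine lintegral_congr_ae ?_
    filter_upwards [hμ] with d hd using busyLaplace_identity hl hs hd)
  have hx := congrArg ENNReal.toReal (laplace_add_mul_laplace_equilibrium hX hs)
  have hr := congrArg ENNReal.toReal (laplace_add_mul_laplace_equilibrium hR hs)
  have eA := (hAle.trans_lt ENNReal.one_lt_top).ne
  have e1 := laplace_ne_top hμ hs.le
  have e2 := laplace_ne_top hμ hl.le
  have e3 := laplace_ne_top hX hs.le
  have e4 := laplace_ne_top hR hs.le
  have e5 := laplace_equilibrium_ne_top hX hs
  have e6 := laplace_equilibrium_ne_top hR hs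
  -- All quantities are finite, so the rest is algebra over the reals.
  generalize (∫⁻ d, busyLaplace lam s d ∂μ) = A at *
  generalize laplace μ s = φ at *
  generalize laplace μ lam = ψ at *
  generalize laplace X s = x at *
  generalize laplace (residualLaw lam V) s = r at *
  generalize laplace (equilibrium X) s = ex at *
  generalize laplace (equilibrium (residualLaw lam V)) s = er at *
  lift A to NNReal using eA
  lift φ to NNReal using e1
  lift ψ to NNReal using e2
  lift x to NNReal using e3
  lift r to NNReal using e4
  lift ex to NNReal using e5
  lift er to NNReal using e6
  simp only [ENNReal.ofReal, measure_univ] at hA hx hr ⊢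
  norm_cast at hA hx hr ⊢
  simp only [← NNReal.coe_inj, NNReal.coe_add, NNReal.coe_mul, Real.coe_toNNReal _ hl.le,
    Real.coe_toNNReal _ hs.le, ENNReal.coe_toReal] at hA hx hr ⊢
  -- The defect of stationarity times `λ - s` equals the defect of the renewal equation times `s`;
  -- as neither factor is zero, the defects vanish together.
  have key : (lam - s) * ((x : ℝ) * (A + ψ * r) - φ) =
      s * (φ - (lam * ex * φ + ψ * (x * (lam * er + r)))) := by
    linear_combination (x : ℝ) * hA + (lam * φ) * hx + (lam * ψ * x) * hr
  constructor
  · intro h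
    rw [h, sub_self, mul_zero, eq_comm, mul_eq_zero] at key
    exact sub_eq_zero.mp (key.resolve_left hs.ne')
  · intro h
    rw [← h, sub_self, mul_zero, mul_eq_zero] at key
    exact sub_eq_zero.mp (key.resolve_left (sub_ne_zero.mpr hsl.symm))

lemma ae_nonneg_add {μ ν : Measure ℝ} (hμ : ∀ᵐ x ∂μ, 0 ≤ x) (hν : ∀ᵐ x ∂ν, 0 ≤ x) :
    ∀ᵐ x ∂(μ + ν), 0 ≤ x := by
  rw [ae_add_measure_iff]; exact ⟨hμ, hν⟩

lemma ae_nonneg_seedLaw [IsProbabilityMeasure X] [IsProbabilityMeasure V] (hl : 0 < lam)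
    (hX : ∀ᵐ x ∂X, 0 ≤ x) (hR : ∀ᵐ x ∂residualLaw lam V, 0 ≤ x) :
    ∀ᵐ x ∂seedLaw lam X V, 0 ≤ x := by
  have := isProbabilityMeasure_residualLaw hl V
  exact ae_nonneg_conv hX
    (ae_nonneg_add (Measure.ae_smul_measure (ae_nonneg_equilibrium _) _) hR)

lemma seedLaw_univ [IsProbabilityMeasure X] [IsProbabilityMeasure V] (hl : 0 < lam) :
    seedLaw lam X V univ = ENNReal.ofReal lam * posMoment (residualLaw lam V) 1 + 1 := by
  have := isProbabilityMeasure_residualLaw hl V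
  have h := laplace_seedLaw (lam := lam) (X := X) (V := V) hl 0
  simpa [laplace, equilibrium_univ] using h

/-- The limit `s ↓ 0` of the renewal equation, where transforms become masses. It is taken before
the mean service time is known to be finite. -/
lemma stationary_mass_equation [IsProbabilityMeasure X] [IsProbabilityMeasure V] (hl : 0 < lam)
    (hX : ∀ᵐ x ∂X, 0 ≤ x) (hR : ∀ᵐ x ∂residualLaw lam V, 0 ≤ x)
    {μ : Measure ℝ} [IsProbabilityMeasure μ] (hμ : ∀ᵐ x ∂μ, 0 ≤ x)
    (hst : nextDelayLaw lam X V μ = μ) :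
    1 = ENNReal.ofReal lam * posMoment X 1 + laplace μ lam * seedLaw lam X V univ := by
  have t1 := tendsto_laplace hμ
  have t2 := tendsto_laplace (ae_nonneg_equilibrium X)
  have t3 := tendsto_laplace (ae_nonneg_seedLaw hl hX hR)
  rw [measure_univ] at t1
  rw [equilibrium_univ] at t2
  have hψ := laplace_ne_top hμ hl.le
  -- The equilibrium mass may be infinite here; the product still converges because the other factor
  -- tends to `1`, neither `0` nor `∞`.
  have t4 := (ENNReal.Tendsto.mul (ENNReal.Tendsto.const_mul (a := ENNReal.ofReal lam) t2
    (Or.inr ENNReal.ofReal_ne_top)) (Or.inr ENNReal.one_ne_top) t1 (Or.inl one_ne_zero)).add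
      (ENNReal.Tendsto.const_mul (a := laplace μ lam) t3 (Or.inr hψ))
  rw [mul_one] at t4
  refine tendsto_nhds_unique (t1.congr' ?_) t4
  have hev : ∀ᶠ n : ℕ in atTop, 1 / ((n : ℝ) + 1) < lam :=
    tendsto_one_div_add_atTop_nhds_zero_nat.eventually (gt_mem_nhds hl)
  filter_upwards [hev] with n hn
  exact (laplace_nextDelayLaw_eq_iff hl hX hR hμ (by positivity) hn.ne).mp (by rw [hst])

/-- The terms of the series for the stationary delay law. -/
def delaySeries (lam : ℝ) (X : Measure ℝ) (V : Measure (ℕ → ℝ)) : ℕ → Measure ℝ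
  | 0 => ((1 - ENNReal.ofReal lam * posMoment X 1) / seedLaw lam X V univ) • seedLaw lam X V
  | n + 1 => (ENNReal.ofReal lam • equilibrium X).conv (delaySeries lam X V n)

/-- The stationary delay law, as a sum over the number of terms in the Pollaczek–Khinchine
geometric compound. -/
def delayLaw (lam : ℝ) (X : Measure ℝ) (V : Measure (ℕ → ℝ)) : Measure ℝ :=
  Measure.sum (delaySeries lam X V)

lemma rho_lt_one_of_stationary [IsProbabilityMeasure X] [IsProbabilityMeasure V] (hl : 0 < lam)
    (hX : ∀ᵐ x ∂X, 0 ≤ x) (hR : ∀ᵐ x ∂residualLaw lam V, 0 ≤ x)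
    {μ : Measure ℝ} [IsProbabilityMeasure μ] (hμ : ∀ᵐ x ∂μ, 0 ≤ x)
    (hst : nextDelayLaw lam X V μ = μ) : ENNReal.ofReal lam * posMoment X 1 < 1 := by
  have h := stationary_mass_equation hl hX hR hμ hst
  have h0 : laplace μ lam * seedLaw lam X V univ ≠ 0 :=
    mul_ne_zero (laplace_pos μ lam).ne' (by rw [seedLaw_univ hl]; simp)
  have ht : ENNReal.ofReal lam * posMoment X 1 ≠ ∞ := fun h' => by simp [h'] at h
  calc ENNReal.ofReal lam * posMoment X 1
      < ENNReal.ofReal lam * posMoment X 1 + laplace μ lam * seedLaw lam X V univ :=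
        ENNReal.lt_add_right ht h0
    _ = 1 := h.symm

/-- Finiteness is essential: for `q > 0`, `∞` is a further fixed point. -/
lemma eq_of_eq_mul_add {q b x y : ℝ≥0∞} (hq : q < 1) (hx : x ≠ ∞) (hy : y ≠ ∞)
    (ex : x = q * x + b) (ey : y = q * y + b) : x = y := by
  have hb : b ≠ ∞ := ne_top_of_le_ne_top hx (by rw [ex]; exact le_add_self)
  lift q to NNReal using hq.ne_top
  lift x to NNReal using hx
  lift y to NNReal using hy
  lift b to NNReal using hb
  norm_cast at *
  have hq' : (q : ℝ) < 1 := by exact_mod_cast hq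
  have ex' : (x : ℝ) = q * x + b := by exact_mod_cast ex
  have ey' : (y : ℝ) = q * y + b := by exact_mod_cast ey
  have : (1 - (q : ℝ)) * (x - y) = 0 := by linear_combination ex' - ey'
  rcases mul_eq_zero.mp this with h | h
  · linarith
  · exact NNReal.coe_injective (sub_eq_zero.mp h)

lemma rho_laplace_lt_one [SFinite X] {s : ℝ} (hs : 0 ≤ s)
    (hρ : ENNReal.ofReal lam * posMoment X 1 < 1) :
    ENNReal.ofReal lam * laplace (equilibrium X) s < 1 := by
  refine lt_of_le_of_lt ?_ hρ
  gcongr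
  rw [← equilibrium_univ]
  exact laplace_le_mass (ae_nonneg_equilibrium X) hs

theorem stationary_unique [IsProbabilityMeasure X] [IsProbabilityMeasure V] (hl : 0 < lam)
    (hX : ∀ᵐ x ∂X, 0 ≤ x) (hR : ∀ᵐ x ∂residualLaw lam V, 0 ≤ x)
    {μ ν : Measure ℝ} [IsProbabilityMeasure μ] [IsProbabilityMeasure ν]
    (hμ : ∀ᵐ x ∂μ, 0 ≤ x) (hν : ∀ᵐ x ∂ν, 0 ≤ x)
    (hμs : nextDelayLaw lam X V μ = μ) (hνs : nextDelayLaw lam X V ν = ν) : μ = ν := by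
  have hρ := rho_lt_one_of_stationary hl hX hR hμ hμs
  have h1 := stationary_mass_equation hl hX hR hμ hμs
  have h2 := stationary_mass_equation hl hX hR hν hνs
  have hM0 : seedLaw lam X V univ ≠ 0 := by rw [seedLaw_univ hl]; simp
  have hMt : seedLaw lam X V univ ≠ ∞ := fun h => by
    simp [h, ENNReal.mul_top (laplace_pos μ lam).ne'] at h1
  have hψ : laplace μ lam = laplace ν lam := by
    have := ENNReal.add_right_inj hρ.ne_top |>.mp (h1.symm.trans h2)
    exact (ENNReal.mul_left_inj hM0 hMt).mp this
  -- The multiples of `2λ` determine the measure and avoid `s = λ`, where the renewal equation is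
  -- not available; `k = 0` compares masses only.
  refine ext_of_laplace_eq hμ hν (c := 2 * lam) (by positivity) fun k => ?_
  rcases k.eq_zero_or_pos with rfl | hk
  · simp [laplace]
  have hk1 : (1 : ℝ) ≤ k := by exact_mod_cast hk
  have hs : (0 : ℝ) < k * (2 * lam) := by positivity
  have hsl : (k : ℝ) * (2 * lam) ≠ lam := by nlinarith
  refine eq_of_eq_mul_add (rho_laplace_lt_one hs.le hρ) (laplace_ne_top hμ hs.le)
    (laplace_ne_top hν hs.le)
    ((laplace_nextDelayLaw_eq_iff hl hX hR hμ hs hsl).mp (by rw [hμs])) ?_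
  rw [hψ]
  exact (laplace_nextDelayLaw_eq_iff hl hX hR hν hs hsl).mp (by rw [hνs])

lemma posMoment_lt_top_of_bounded {μ : Measure ℝ} [IsFiniteMeasure μ] {B : ℝ}
    (h : ∀ᵐ x ∂μ, x ∈ Icc 0 B) (k : ℕ) : posMoment μ k < ∞ := by
  calc posMoment μ k ≤ ∫⁻ _x, ENNReal.ofReal B ^ k ∂μ := lintegral_mono_ae <| by
        filter_upwards [h] with x hx
        gcongr
        exact hx.2
    _ < ∞ := by
        rw [lintegral_const]
        exact ENNReal.mul_lt_top (ENNReal.pow_lt_top ENNReal.ofReal_lt_top) (measure_lt_top _ _)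

lemma seedLaw_univ_ne_top [IsProbabilityMeasure X] [IsProbabilityMeasure V] (hl : 0 < lam)
    (hR : ∀ᵐ x ∂residualLaw lam V, x ∈ Icc 0 B) : seedLaw lam X V univ ≠ ∞ := by
  have := isProbabilityMeasure_residualLaw hl V
  rw [seedLaw_univ hl]
  exact ENNReal.add_ne_top.mpr ⟨ENNReal.mul_ne_top ENNReal.ofReal_ne_top
    (posMoment_lt_top_of_bounded hR 1).ne, ENNReal.one_ne_top⟩

lemma isFiniteMeasure_rate_equilibrium [SFinite X]
    (hρ : ENNReal.ofReal lam * posMoment X 1 < 1) :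
    IsFiniteMeasure (ENNReal.ofReal lam • equilibrium X) :=
  ⟨by simpa [equilibrium_univ] using hρ.trans ENNReal.one_lt_top⟩

/-! ### Existence: the geometric compound is stationary. -/

lemma isFiniteMeasure_delaySeries [IsProbabilityMeasure X] [IsProbabilityMeasure V] (hl : 0 < lam)
    (hR : ∀ᵐ x ∂residualLaw lam V, x ∈ Icc 0 B)
    (hρ : ENNReal.ofReal lam * posMoment X 1 < 1) (n : ℕ) :
    IsFiniteMeasure (delaySeries lam X V n) := by
  have := isFiniteMeasure_rate_equilibrium hρ
  induction n with
  | zero =>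
    have hM := seedLaw_univ_ne_top (X := X) hl hR
    refine ⟨?_⟩
    rw [delaySeries, Measure.smul_apply, smul_eq_mul]
    refine ENNReal.mul_lt_top (ENNReal.div_lt_top ?_ ?_) hM.lt_top
    · exact ne_top_of_le_ne_top ENNReal.one_ne_top tsub_le_self
    · rw [seedLaw_univ hl]; simp
  | succ n ih => rw [delaySeries]; infer_instance

lemma ae_nonneg_rate_equilibrium [SFinite X] :
    ∀ᵐ x ∂(ENNReal.ofReal lam • equilibrium X), 0 ≤ x :=
  Measure.ae_smul_measure (ae_nonneg_equilibrium X) _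

lemma ae_nonneg_delaySeries [IsProbabilityMeasure X] [IsProbabilityMeasure V] (hl : 0 < lam)
    (hX : ∀ᵐ x ∂X, 0 ≤ x) (hR : ∀ᵐ x ∂residualLaw lam V, x ∈ Icc 0 B)
    (hρ : ENNReal.ofReal lam * posMoment X 1 < 1) (n : ℕ) :
    ∀ᵐ x ∂delaySeries lam X V n, 0 ≤ x := by
  have hfin := isFiniteMeasure_delaySeries (X := X) hl hR hρ
  have := isFiniteMeasure_rate_equilibrium hρ
  induction n with
  | zero => exact Measure.ae_smul_measure (ae_nonneg_seedLaw hl hX (hR.mono fun x hx => hx.1)) _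
  | succ n ih => exact ae_nonneg_conv ae_nonneg_rate_equilibrium ih

/-- Splitting off the zeroth term of the series gives the renewal equation, with the prescribed
constant in the place of the transform at `lam`. -/
lemma laplace_delayLaw [IsProbabilityMeasure X] [IsProbabilityMeasure V] (hl : 0 < lam)
    (hR : ∀ᵐ x ∂residualLaw lam V, x ∈ Icc 0 B)
    (hρ : ENNReal.ofReal lam * posMoment X 1 < 1) (s : ℝ) :
    laplace (delayLaw lam X V) s =
      ENNReal.ofReal lam * laplace (equilibrium X) s * laplace (delayLaw lam X V) s +
      (1 - ENNReal.ofReal lam * posMoment X 1) / seedLaw lam X V univ *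
        laplace (seedLaw lam X V) s := by
  have hfin := isFiniteMeasure_delaySeries (X := X) hl hR hρ
  have := isFiniteMeasure_rate_equilibrium hρ
  have h : laplace (delayLaw lam X V) s = ∑' n, laplace (delaySeries lam X V n) s := by
    rw [laplace, delayLaw, lintegral_sum_measure]; rfl
  have hsucc (n : ℕ) : laplace (delaySeries lam X V (n + 1)) s =
      ENNReal.ofReal lam * laplace (equilibrium X) s * laplace (delaySeries lam X V n) s := by
    rw [delaySeries, laplace_conv, laplace_smul]
  conv_lhs => rw [h, tsum_eq_zero_add' ENNReal.summable]
  simp only [hsucc]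
  rw [ENNReal.tsum_mul_left, ← h, delaySeries, laplace_smul, add_comm]

lemma delaySeries_zero_univ [IsProbabilityMeasure X] [IsProbabilityMeasure V] (hl : 0 < lam)
    (hR : ∀ᵐ x ∂residualLaw lam V, x ∈ Icc 0 B) :
    delaySeries lam X V 0 univ = 1 - ENNReal.ofReal lam * posMoment X 1 := by
  rw [delaySeries, Measure.smul_apply, smul_eq_mul, ENNReal.div_mul_cancel]
  · rw [seedLaw_univ hl]; simp
  · exact seedLaw_univ_ne_top hl hR

lemma delaySeries_succ_univ [IsProbabilityMeasure X] [IsProbabilityMeasure V] (hl : 0 < lam)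
    (hR : ∀ᵐ x ∂residualLaw lam V, x ∈ Icc 0 B)
    (hρ : ENNReal.ofReal lam * posMoment X 1 < 1) (n : ℕ) :
    delaySeries lam X V (n + 1) univ =
      ENNReal.ofReal lam * posMoment X 1 * delaySeries lam X V n univ := by
  have hfin := isFiniteMeasure_delaySeries (X := X) hl hR hρ
  have := isFiniteMeasure_rate_equilibrium hρ
  have h := laplace_conv (ENNReal.ofReal lam • equilibrium X) (delaySeries lam X V n) 0
  rw [laplace_smul] at h
  simpa [laplace, delaySeries, equilibrium_univ] using h

lemma tsum_delaySeries_univ_lt_top [IsProbabilityMeasure X] [IsProbabilityMeasure V] (hl : 0 < lam)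
    (hR : ∀ᵐ x ∂residualLaw lam V, x ∈ Icc 0 B)
    (hρ : ENNReal.ofReal lam * posMoment X 1 < 1) :
    ∑' n, delaySeries lam X V n univ < ∞ := by
  have hfin := isFiniteMeasure_delaySeries (X := X) hl hR hρ
  refine tsum_lt_top_of_le_mul_add hρ (b := 0) (measure_lt_top _ _) (by simp) fun n => ?_
  simp [delaySeries_succ_univ hl hR hρ]

lemma isProbabilityMeasure_delayLaw [IsProbabilityMeasure X] [IsProbabilityMeasure V] (hl : 0 < lam)
    (hR : ∀ᵐ x ∂residualLaw lam V, x ∈ Icc 0 B)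
    (hρ : ENNReal.ofReal lam * posMoment X 1 < 1) :
    IsProbabilityMeasure (delayLaw lam X V) := by
  have hlt : delayLaw lam X V univ < ∞ := by
    rw [delayLaw, Measure.sum_apply _ MeasurableSet.univ]
    exact tsum_delaySeries_univ_lt_top hl hR hρ
  -- The total mass and `1` are both finite fixed points of `m ↦ ρ m + (1 - ρ)`.
  refine ⟨eq_of_eq_mul_add hρ hlt.ne ENNReal.one_ne_top
    (b := 1 - ENNReal.ofReal lam * posMoment X 1) ?_ ?_⟩
  · conv_lhs => rw [delayLaw, Measure.sum_apply _ MeasurableSet.univ,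
      tsum_eq_zero_add' ENNReal.summable]
    simp only [delaySeries_succ_univ hl hR hρ]
    rw [ENNReal.tsum_mul_left, delaySeries_zero_univ hl hR, add_comm, delayLaw,
      Measure.sum_apply _ MeasurableSet.univ]
  · rw [mul_one, add_tsub_cancel_of_le hρ.le]

lemma ae_nonneg_delayLaw [IsProbabilityMeasure X] [IsProbabilityMeasure V] (hl : 0 < lam)
    (hX : ∀ᵐ x ∂X, 0 ≤ x) (hR : ∀ᵐ x ∂residualLaw lam V, x ∈ Icc 0 B)
    (hρ : ENNReal.ofReal lam * posMoment X 1 < 1) :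
    ∀ᵐ x ∂delayLaw lam X V, 0 ≤ x := by
  rw [delayLaw, Measure.ae_sum_iff' measurableSet_Ici]
  exact ae_nonneg_delaySeries hl hX hR hρ

/-- The consistency check that makes the series a genuine solution: its constant must equal its own
transform at `lam`. At `s = λ` the vacation factor of the seed is `λ R̂_e + R̂ = 1`, and `1 - λ X̂_e
= X̂`; so the equation reads `D̂ X̂ = c X̂`, with `D̂` the transform of the series and `c` its
constant, and `X̂ > 0` cancels. -/
lemma laplace_delayLaw_rate [IsProbabilityMeasure X] [IsProbabilityMeasure V] (hl : 0 < lam)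
    (hX : ∀ᵐ x ∂X, 0 ≤ x) (hR : ∀ᵐ x ∂residualLaw lam V, x ∈ Icc 0 B)
    (hρ : ENNReal.ofReal lam * posMoment X 1 < 1) :
    laplace (delayLaw lam X V) lam =
      (1 - ENNReal.ofReal lam * posMoment X 1) / seedLaw lam X V univ := by
  have := isProbabilityMeasure_residualLaw hl V
  have := isProbabilityMeasure_delayLaw (X := X) hl hR hρ
  have hD := laplace_ne_top (ae_nonneg_delayLaw hl hX hR hρ) hl.le
  have h := laplace_delayLaw (X := X) hl hR hρ lam
  have hx := laplace_add_mul_laplace_equilibrium hX hl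
  have hr := laplace_add_mul_laplace_equilibrium (hR.mono fun x hx => hx.1) hl
  rw [measure_univ] at hx hr
  rw [laplace_seedLaw hl, add_comm (_ * laplace (equilibrium (residualLaw lam V)) lam), hr,
    mul_one] at h
  have h' : laplace (delayLaw lam X V) lam =
      ENNReal.ofReal lam * laplace (equilibrium X) lam * laplace (delayLaw lam X V) lam +
        laplace (delayLaw lam X V) lam * laplace X lam := by
    rw [mul_comm _ (laplace X lam), ← add_mul, add_comm, hx, one_mul]
  have hq : ENNReal.ofReal lam * laplace (equilibrium X) lam * laplace (delayLaw lam X V) lam ≠ ∞ :=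
    ENNReal.mul_ne_top (rho_laplace_lt_one hl.le hρ).ne_top hD
  have := (ENNReal.add_right_inj hq).mp (h'.symm.trans h)
  exact (ENNReal.mul_left_inj (laplace_pos X lam).ne' (laplace_ne_top hX hl.le)).mp this

lemma ae_nonneg_nextDelayLaw [IsProbabilityMeasure X] [IsProbabilityMeasure V] (hl : 0 < lam)
    (hX : ∀ᵐ x ∂X, 0 ≤ x) (ha : 0 < a) (hV : ∀ᵐ v ∂V, ∀ k, v k ∈ Icc a B) (μ : Measure ℝ) :
    ∀ᵐ x ∂nextDelayLaw lam X V μ, 0 ≤ x := by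
  have := isProbabilityMeasure_expMeasure hl
  rw [nextDelayLaw, ae_map_iff measurable_nextDelay.aemeasurable measurableSet_Ici]
  have h1 : ∀ᵐ ω ∂μ.prod ((expMeasure lam).prod (X.prod V)), 0 ≤ ω.2.2.1 :=
    (Measure.quasiMeasurePreserving_fst.comp (Measure.quasiMeasurePreserving_snd.comp
      Measure.quasiMeasurePreserving_snd)).ae hX
  have h2 : ∀ᵐ ω ∂μ.prod ((expMeasure lam).prod (X.prod V)), ∀ k, ω.2.2.2 k ∈ Icc a B :=
    (Measure.quasiMeasurePreserving_snd.comp (Measure.quasiMeasurePreserving_snd.comp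
      Measure.quasiMeasurePreserving_snd)).ae hV
  filter_upwards [h1, h2] with ω h1 h2
  unfold nextDelay
  split_ifs with h
  · linarith
  · have := (vacationEnd_sub_mem_Icc ha h2 (sub_nonneg.mpr (not_le.mp h).le)).1
    linarith

theorem nextDelayLaw_delayLaw [IsProbabilityMeasure X] [IsProbabilityMeasure V] (hl : 0 < lam)
    (hX : ∀ᵐ x ∂X, 0 ≤ x) (ha : 0 < a) (hV : ∀ᵐ v ∂V, ∀ k, v k ∈ Icc a B)
    (hρ : ENNReal.ofReal lam * posMoment X 1 < 1) :
    nextDelayLaw lam X V (delayLaw lam X V) = delayLaw lam X V := by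
  have hR := ae_residualLaw_mem_Icc hl ha hV
  have := isProbabilityMeasure_expMeasure hl
  have := isProbabilityMeasure_delayLaw (X := X) hl hR hρ
  have : IsProbabilityMeasure (nextDelayLaw lam X V (delayLaw lam X V)) :=
    Measure.isProbabilityMeasure_map measurable_nextDelay.aemeasurable
  have hD := ae_nonneg_delayLaw hl hX hR hρ
  refine ext_of_laplace_eq (ae_nonneg_nextDelayLaw hl hX ha hV _) hD (c := 2 * lam)
    (by positivity) fun k => ?_
  rcases k.eq_zero_or_pos with rfl | hk
  · simp [laplace]
  have hk1 : (1 : ℝ) ≤ k := by exact_mod_cast hk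
  have hs : (0 : ℝ) < k * (2 * lam) := by positivity
  have hsl : (k : ℝ) * (2 * lam) ≠ lam := by nlinarith
  rw [laplace_nextDelayLaw_eq_iff hl hX (hR.mono fun x hx => hx.1) hD hs hsl,
    laplace_delayLaw_rate hl hX hR hρ]
  exact laplace_delayLaw hl hR hρ _

/-! ### Moments of the delay. -/

lemma posMoment_delayLaw (k : ℕ) :
    posMoment (delayLaw lam X V) k = ∑' n, posMoment (delaySeries lam X V n) k := by
  rw [posMoment, delayLaw, lintegral_sum_measure]; rfl

lemma posMoment_delaySeries_zero_lt_top [IsProbabilityMeasure X] [IsProbabilityMeasure V]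
    (hl : 0 < lam) (hX : ∀ᵐ x ∂X, 0 ≤ x) (hR : ∀ᵐ x ∂residualLaw lam V, x ∈ Icc 0 B)
    (h1 : posMoment X 1 < ∞) : posMoment (delaySeries lam X V 0) 1 < ∞ ∧
      (posMoment X 2 < ∞ → posMoment (delaySeries lam X V 0) 2 < ∞) := by
  have := isProbabilityMeasure_residualLaw hl V
  have hR0 := hR.mono fun x hx => hx.1
  have hY : ∀ᵐ x ∂(ENNReal.ofReal lam • equilibrium (residualLaw lam V) + residualLaw lam V),
      0 ≤ x := ae_nonneg_add (Measure.ae_smul_measure (ae_nonneg_equilibrium _) _) hR0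
  have hYm (k : ℕ) : posMoment (ENNReal.ofReal lam • equilibrium (residualLaw lam V) +
      residualLaw lam V) k < ∞ := by
    rw [posMoment_add, posMoment_smul]
    exact ENNReal.add_lt_top.mpr ⟨ENNReal.mul_lt_top ENNReal.ofReal_lt_top
      ((posMoment_equilibrium_lt_top_iff _ k).mpr (posMoment_lt_top_of_bounded hR _)),
      posMoment_lt_top_of_bounded hR _⟩
  have h0 : posMoment X 0 < ∞ := by simp [posMoment_zero]
  have hc : (1 - ENNReal.ofReal lam * posMoment X 1) / seedLaw lam X V univ < ∞ :=
    ENNReal.div_lt_top (ne_top_of_le_ne_top ENNReal.one_ne_top tsub_le_self)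
      (by rw [seedLaw_univ hl]; simp)
  rw [delaySeries, posMoment_smul, posMoment_smul, seedLaw, posMoment_one_conv hX hY,
    posMoment_two_conv hX hY]
  refine ⟨ENNReal.mul_lt_top hc (ENNReal.add_lt_top.mpr ⟨?_, ?_⟩), fun h2 =>
    ENNReal.mul_lt_top hc (ENNReal.add_lt_top.mpr ⟨ENNReal.add_lt_top.mpr ⟨?_, ?_⟩, ?_⟩)⟩
  all_goals first
    | exact ENNReal.mul_lt_top (by assumption) (hYm _)
    | exact ENNReal.mul_lt_top (by simp) (ENNReal.mul_lt_top h1 (hYm _))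

/-- The first moments of the terms obey a recursion with ratio `ρ < 1`, whose inhomogeneity is a
multiple of the summable masses. -/
theorem posMoment_one_delayLaw_lt_top [IsProbabilityMeasure X] [IsProbabilityMeasure V]
    (hl : 0 < lam) (hX : ∀ᵐ x ∂X, 0 ≤ x) (hR : ∀ᵐ x ∂residualLaw lam V, x ∈ Icc 0 B)
    (hρ : ENNReal.ofReal lam * posMoment X 1 < 1) (h1 : posMoment X 1 < ∞)
    (h2 : posMoment X 2 < ∞) : posMoment (delayLaw lam X V) 1 < ∞ := by
  have hfin := isFiniteMeasure_delaySeries (X := X) hl hR hρ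
  have := isFiniteMeasure_rate_equilibrium hρ
  rw [posMoment_delayLaw]
  refine tsum_lt_top_of_le_mul_add hρ (b := fun n =>
    ENNReal.ofReal lam * posMoment (equilibrium X) 1 * delaySeries lam X V n univ)
    (posMoment_delaySeries_zero_lt_top hl hX hR h1).1 ?_ fun n => ?_
  · rw [ENNReal.tsum_mul_left]
    exact ENNReal.mul_lt_top (ENNReal.mul_lt_top ENNReal.ofReal_lt_top
      ((posMoment_equilibrium_lt_top_iff X 1).mpr h2)) (tsum_delaySeries_univ_lt_top hl hR hρ)
  · rw [delaySeries, posMoment_one_conv ae_nonneg_rate_equilibrium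
      (ae_nonneg_delaySeries hl hX hR hρ n), posMoment_smul, posMoment_smul,
      posMoment_zero, posMoment_zero, equilibrium_univ, add_comm]

/-- The same recursion for second moments; the cross terms are summable by the first-moment result.
-/
theorem posMoment_two_delayLaw_lt_top [IsProbabilityMeasure X] [IsProbabilityMeasure V]
    (hl : 0 < lam) (hX : ∀ᵐ x ∂X, 0 ≤ x) (hR : ∀ᵐ x ∂residualLaw lam V, x ∈ Icc 0 B)
    (hρ : ENNReal.ofReal lam * posMoment X 1 < 1) (h1 : posMoment X 1 < ∞)
    (h2 : posMoment X 2 < ∞) (h3 : posMoment X 3 < ∞) : posMoment (delayLaw lam X V) 2 < ∞ := by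
  have hfin := isFiniteMeasure_delaySeries (X := X) hl hR hρ
  have := isFiniteMeasure_rate_equilibrium hρ
  have hm1 := posMoment_one_delayLaw_lt_top hl hX hR hρ h1 h2
  rw [posMoment_delayLaw] at hm1 ⊢
  refine tsum_lt_top_of_le_mul_add hρ (b := fun n =>
    ENNReal.ofReal lam * posMoment (equilibrium X) 2 * delaySeries lam X V n univ +
      2 * (ENNReal.ofReal lam * posMoment (equilibrium X) 1) * posMoment (delaySeries lam X V n) 1)
    ((posMoment_delaySeries_zero_lt_top hl hX hR h1).2 h2) ?_ fun n => ?_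
  · rw [ENNReal.tsum_add, ENNReal.tsum_mul_left, ENNReal.tsum_mul_left]
    refine ENNReal.add_lt_top.mpr ⟨ENNReal.mul_lt_top (ENNReal.mul_lt_top ENNReal.ofReal_lt_top
      ((posMoment_equilibrium_lt_top_iff X 2).mpr h3)) (tsum_delaySeries_univ_lt_top hl hR hρ),
      ENNReal.mul_lt_top (ENNReal.mul_lt_top (by simp) (ENNReal.mul_lt_top ENNReal.ofReal_lt_top
      ((posMoment_equilibrium_lt_top_iff X 1).mpr h2))) hm1⟩
  · rw [delaySeries, posMoment_two_conv ae_nonneg_rate_equilibrium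
      (ae_nonneg_delaySeries hl hX hR hρ n), posMoment_smul, posMoment_smul, posMoment_smul,
      posMoment_zero, posMoment_zero, equilibrium_univ]
    apply le_of_eq
    ring

/-- A single term suffices: the term `n = 1` adds a nonnegative variable to one with law
proportional to the equilibrium measure, and its weight is positive because `ρ < 1`. -/
lemma posMoment_succ_lt_top_of_delayLaw [IsProbabilityMeasure X] [IsProbabilityMeasure V]
    (hl : 0 < lam) (hX : ∀ᵐ x ∂X, 0 ≤ x) (hR : ∀ᵐ x ∂residualLaw lam V, x ∈ Icc 0 B)
    (hρ : ENNReal.ofReal lam * posMoment X 1 < 1) {k : ℕ}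
    (h : posMoment (delayLaw lam X V) k < ∞) : posMoment X (k + 1) < ∞ := by
  have hfin := isFiniteMeasure_delaySeries (X := X) hl hR hρ
  have := isFiniteMeasure_rate_equilibrium hρ
  rw [← posMoment_equilibrium_lt_top_iff]
  have hle : ENNReal.ofReal lam * posMoment (equilibrium X) k *
      (1 - ENNReal.ofReal lam * posMoment X 1) ≤ posMoment (delayLaw lam X V) k := by
    calc ENNReal.ofReal lam * posMoment (equilibrium X) k *
          (1 - ENNReal.ofReal lam * posMoment X 1)
        = ∫⁻ x, ∫⁻ _y, ENNReal.ofReal x ^ k ∂delaySeries lam X V 0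
            ∂(ENNReal.ofReal lam • equilibrium X) := by
          simp only [lintegral_const, delaySeries_zero_univ hl hR]
          rw [lintegral_mul_const _ (by fun_prop), ← posMoment_smul]
          rfl
      _ ≤ posMoment (delaySeries lam X V 1) k := by
          rw [show delaySeries lam X V 1 =
            (ENNReal.ofReal lam • equilibrium X).conv (delaySeries lam X V 0) from rfl,
            posMoment, Measure.lintegral_conv (by fun_prop)]
          refine lintegral_mono fun x => lintegral_mono_ae ?_
          filter_upwards [ae_nonneg_delaySeries hl hX hR hρ 0] with y hy
          gcongr
          linarith
      _ ≤ posMoment (delayLaw lam X V) k := by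
          rw [posMoment_delayLaw]; exact ENNReal.le_tsum 1
  have h1 := ENNReal.lt_top_of_mul_ne_top_left (hle.trans_lt h).ne (tsub_pos_of_lt hρ).ne'
  exact ENNReal.lt_top_of_mul_ne_top_right h1.ne (by simpa using hl)

end Queue

/-! ### Moments of the medium-access delay. -/

namespace Network

variable (S : Network)

lemma measurable_accessDelay :
    Measurable fun ω : ℕ × (ℕ → ℕ) × (ℕ → ℕ → ℝ) => S.accessDelay ω.1 ω.2.1 ω.2.2 := by
  refine measurable_from_prod_countable_right fun j => ?_
  have h (i : ℕ) : Measurable fun q : (ℕ → ℕ) × (ℕ → ℕ → ℝ) =>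
      ∑ m ∈ Finset.range (q.1 i), q.2 i m := by
    have hF : Measurable fun q : ℕ × (ℕ → ℕ → ℝ) => ∑ m ∈ Finset.range q.1, q.2 i m :=
      measurable_from_prod_countable_right fun n => by
        show Measurable fun l : ℕ → ℕ → ℝ => ∑ m ∈ Finset.range n, l i m
        fun_prop
    exact hF.comp (f := fun q : (ℕ → ℕ) × (ℕ → ℕ → ℝ) => (q.1 i, q.2)) (by fun_prop)
  show Measurable fun q : (ℕ → ℕ) × (ℕ → ℕ → ℝ) =>
    (∑ i ∈ Finset.range (j + 1), ∑ m ∈ Finset.range (q.1 i), q.2 i m) + j * S.Tcoll + S.Tsucc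
  exact ((Finset.measurable_fun_sum _ fun i _ => h i).add_const _).add_const _

instance : IsProbabilityMeasure S.accessLaw :=
  Measure.isProbabilityMeasure_map S.measurable_accessDelay.aemeasurable

/-- The length of the shortest kind of slot. -/
def Tmin : ℝ := min S.Tidle (min S.Tcoll S.Tsucc)

/-- The length of the longest kind of slot. -/
def Tmax : ℝ := max S.Tidle (max S.Tcoll S.Tsucc)

lemma Tmin_pos : 0 < S.Tmin := lt_min S.Tidle_pos (lt_min S.Tcoll_pos S.Tsucc_pos)

lemma Tmax_pos : 0 < S.Tmax := lt_max_of_lt_left S.Tidle_pos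

lemma Tmin_le_Tsucc : S.Tmin ≤ S.Tsucc := (min_le_right _ _).trans (min_le_right _ _)

lemma ae_slotLaw_mem_Icc : ∀ᵐ x ∂S.slotLaw, x ∈ Icc S.Tmin S.Tmax := by
  unfold slotLaw
  rw [ae_add_measure_iff, ae_add_measure_iff]
  refine ⟨⟨?_, ?_⟩, ?_⟩ <;> refine Measure.ae_smul_measure ?_ _ <;>
    rw [ae_dirac_iff (p := fun x => x ∈ Icc S.Tmin S.Tmax) measurableSet_Icc] <;> simp [Tmin, Tmax]

lemma ae_slots_mem_Icc :
    ∀ᵐ v ∂Measure.infinitePi (fun _ : ℕ => S.slotLaw), ∀ k, v k ∈ Icc S.Tmin S.Tmax :=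
  ae_all_iff.mpr fun k => (measurePreserving_eval_infinitePi
    (fun _ : ℕ => S.slotLaw) k).quasiMeasurePreserving.ae S.ae_slotLaw_mem_Icc

lemma ae_backoffLaw_lt (i : ℕ) : ∀ᵐ n ∂S.backoffLaw i, n < S.window i := by
  have h : S.backoffLaw i (Iio (S.window i)) = 1 :=
    uniformOn_self (finite_Iio _) ⟨0, S.window_pos i⟩
  exact (prob_compl_eq_zero_iff (measurableSet_Iio)).mpr h

lemma ae_backoffs_lt : ∀ᵐ b ∂Measure.infinitePi S.backoffLaw, ∀ i, b i < S.window i :=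
  ae_all_iff.mpr fun i => (measurePreserving_eval_infinitePi
    S.backoffLaw i).quasiMeasurePreserving.ae (S.ae_backoffLaw_lt i)

/-- The joint law of the backoff counters and the slot lengths. -/
def counterLaw : Measure ((ℕ → ℕ) × (ℕ → ℕ → ℝ)) :=
  (Measure.infinitePi S.backoffLaw).prod
    (Measure.infinitePi fun _ : ℕ => Measure.infinitePi fun _ : ℕ => S.slotLaw)

instance : IsProbabilityMeasure S.counterLaw := by unfold counterLaw; infer_instance

lemma ae_counterLaw : ∀ᵐ q ∂S.counterLaw,
    (∀ i, q.1 i < S.window i) ∧ ∀ i m, q.2 i m ∈ Icc S.Tmin S.Tmax := by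
  have h1 : ∀ᵐ q ∂S.counterLaw, ∀ i, q.1 i < S.window i :=
    Measure.quasiMeasurePreserving_fst.ae S.ae_backoffs_lt
  have h2 : ∀ᵐ l ∂Measure.infinitePi (fun _ : ℕ => Measure.infinitePi fun _ : ℕ => S.slotLaw),
      ∀ i m, l i m ∈ Icc S.Tmin S.Tmax :=
    ae_all_iff.mpr fun i => (measurePreserving_eval_infinitePi
      (fun _ : ℕ => Measure.infinitePi fun _ : ℕ => S.slotLaw) i).quasiMeasurePreserving.ae
        S.ae_slots_mem_Icc
  have h3 : ∀ᵐ q ∂S.counterLaw, ∀ i m, q.2 i m ∈ Icc S.Tmin S.Tmax :=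
    Measure.quasiMeasurePreserving_snd.ae h2
  filter_upwards [h1, h3] with q h1 h3 using ⟨h1, h3⟩

lemma lintegral_failureLaw (f : ℕ → ℝ≥0∞) :
    ∫⁻ j, f j ∂S.failureLaw = ∑' j, ENNReal.ofReal (S.pc ^ j * (1 - S.pc)) * f j := by
  have h1 : S.pc < 1 := S.collisionProb_lt_one
  rw [failureLaw, geometricMeasure_eq (by
    intro h
    have := congrArg Subtype.val h
    simp at this
    linarith), lintegral_sum_measure]
  simp [lintegral_smul_measure]

lemma posMoment_accessLaw (k : ℕ) :
    posMoment S.accessLaw k = ∑' j, ENNReal.ofReal (S.pc ^ j * (1 - S.pc)) *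
      ∫⁻ q, ENNReal.ofReal (S.accessDelay j q.1 q.2) ^ k ∂S.counterLaw := by
  have hm := S.measurable_accessDelay
  have hm' : Measurable fun ω : ℕ × (ℕ → ℕ) × (ℕ → ℕ → ℝ) =>
    ENNReal.ofReal (S.accessDelay ω.1 ω.2.1 ω.2.2) ^ k := by fun_prop
  rw [posMoment, accessLaw, lintegral_map (by fun_prop) hm, lintegral_prod _ hm'.aemeasurable,
    lintegral_failureLaw]
  rfl

lemma window_le (i : ℕ) : (S.window i : ℝ) ≤ (S.W₀ + 1) * S.r ^ i := by
  have h := (abs_lt.mp (S.window_spec i)).2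
  have h1 : (1 : ℝ) ≤ S.r ^ i := one_le_pow₀ S.one_lt_r.le
  linarith

/-- Add the two bounds `window i > r ^ i - 1` and `window i ≥ 1`; the second covers rounding down of
small windows. -/
lemma le_window (i : ℕ) : S.r ^ i / 2 ≤ S.window i := by
  have h := (abs_lt.mp (S.window_spec i)).1
  have h1 : (1 : ℝ) ≤ S.window i := by exact_mod_cast S.window_pos i
  have h2 : (1 : ℝ) ≤ S.W₀ := by exact_mod_cast S.W₀_pos
  have h3 : (1 : ℝ) ≤ S.r ^ i := one_le_pow₀ S.one_lt_r.le
  nlinarith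

lemma accessDelay_le {j : ℕ} {b : ℕ → ℕ} {l : ℕ → ℕ → ℝ} (hb : ∀ i, b i < S.window i)
    (hl : ∀ i m, l i m ∈ Icc S.Tmin S.Tmax) :
    S.accessDelay j b l ≤
      (S.Tmax * (S.W₀ + 1) + S.Tcoll + S.Tsucc) * (S.r / (S.r - 1)) * S.r ^ j := by
  have hr := S.one_lt_r
  have hT := S.Tmax_pos
  -- A geometric sum with ratio above `1` is comparable to its last term; it also dominates `j + 1`
  -- and so absorbs the collision and success times.
  have hG : ∑ i ∈ Finset.range (j + 1), S.r ^ i ≤ S.r / (S.r - 1) * S.r ^ j := by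
    rw [geom_sum_eq hr.ne', div_mul_eq_mul_div]
    have : 0 < S.r - 1 := by linarith
    gcongr
    rw [pow_succ]
    linarith
  have hG1 : (j : ℝ) + 1 ≤ ∑ i ∈ Finset.range (j + 1), S.r ^ i := by
    calc (j : ℝ) + 1 = ∑ _i ∈ Finset.range (j + 1), (1 : ℝ) := by simp
      _ ≤ _ := Finset.sum_le_sum fun i _ => one_le_pow₀ hr.le
  have hsum : ∑ i ∈ Finset.range (j + 1), ∑ m ∈ Finset.range (b i), l i m ≤
      S.Tmax * (S.W₀ + 1) * ∑ i ∈ Finset.range (j + 1), S.r ^ i := by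
    rw [Finset.mul_sum]
    refine Finset.sum_le_sum fun i _ => ?_
    calc ∑ m ∈ Finset.range (b i), l i m ≤ ∑ _m ∈ Finset.range (b i), S.Tmax :=
          Finset.sum_le_sum fun m _ => (hl i m).2
      _ = b i * S.Tmax := by simp
      _ ≤ S.window i * S.Tmax := by gcongr; exact (hb i).le
      _ ≤ (S.W₀ + 1) * S.r ^ i * S.Tmax := by gcongr; exact S.window_le i
      _ = S.Tmax * (S.W₀ + 1) * S.r ^ i := by ring
  have hc := S.Tcoll_pos
  have hs := S.Tsucc_pos
  have hj : (0 : ℝ) ≤ j := j.cast_nonneg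
  calc S.accessDelay j b l
      ≤ (S.Tmax * (S.W₀ + 1) + S.Tcoll + S.Tsucc) * ∑ i ∈ Finset.range (j + 1), S.r ^ i := by
        unfold accessDelay
        nlinarith
    _ ≤ (S.Tmax * (S.W₀ + 1) + S.Tcoll + S.Tsucc) * (S.r / (S.r - 1) * S.r ^ j) := by gcongr
    _ = _ := by ring

/-- Only the last backoff and the success slot are kept. The success slot gives the `+ 1`, which
later compensates the floor in `window j / 2`. -/
lemma le_accessDelay {j : ℕ} {b : ℕ → ℕ} {l : ℕ → ℕ → ℝ}
    (hl : ∀ i m, l i m ∈ Icc S.Tmin S.Tmax) :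
    S.Tmin * (b j + 1) ≤ S.accessDelay j b l := by
  have h1 : ∑ m ∈ Finset.range (b j), l j m ≤
      ∑ i ∈ Finset.range (j + 1), ∑ m ∈ Finset.range (b i), l i m :=
    Finset.single_le_sum (f := fun i => ∑ m ∈ Finset.range (b i), l i m)
      (fun i _ => Finset.sum_nonneg fun m _ => S.Tmin_pos.le.trans (hl i m).1)
      (Finset.self_mem_range_succ j)
  have h2 : b j * S.Tmin ≤ ∑ m ∈ Finset.range (b j), l j m := by
    calc (b j : ℝ) * S.Tmin = ∑ _m ∈ Finset.range (b j), S.Tmin := by simp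
      _ ≤ _ := Finset.sum_le_sum fun m _ => (hl j m).1
  have h3 : 0 ≤ (j : ℝ) * S.Tcoll := mul_nonneg j.cast_nonneg S.Tcoll_pos.le
  have h4 := S.Tmin_le_Tsucc
  unfold accessDelay
  linarith

lemma ae_nonneg_accessLaw : ∀ᵐ x ∂S.accessLaw, 0 ≤ x := by
  rw [accessLaw, ae_map_iff S.measurable_accessDelay.aemeasurable measurableSet_Ici]
  have h : ∀ᵐ ω ∂S.failureLaw.prod S.counterLaw, ∀ i m, ω.2.2 i m ∈ Icc S.Tmin S.Tmax :=
    Measure.quasiMeasurePreserving_snd.ae (S.ae_counterLaw.mono fun q hq => hq.2)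
  filter_upwards [h] with ω hω
  exact le_trans (mul_nonneg S.Tmin_pos.le (by positivity)) (S.le_accessDelay hω)

lemma half_le_backoffLaw (i : ℕ) : 1 / 2 ≤ S.backoffLaw i (Ici (S.window i / 2)) := by
  classical
  set w := S.window i
  have hw : 0 < w := S.window_pos i
  have hsub : ((Finset.Ico (w / 2) w : Finset ℕ) : Set ℕ) ⊆ Ici (w / 2) := by
    intro n hn
    simp only [Finset.coe_Ico, mem_Ico] at hn
    exact hn.1
  refine le_trans ?_ (measure_mono hsub)
  have e : (Iio w : Set ℕ) = ((Finset.range w : Finset ℕ) : Set ℕ) := by simp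
  rw [backoffLaw, e, uniformOn_apply_finset]
  have hi : Finset.range w ∩ Finset.Ico (w / 2) w = Finset.Ico (w / 2) w := by
    ext n; simp
  rw [hi, Nat.card_Ico, Finset.card_range]
  rw [ENNReal.le_div_iff_mul_le (Or.inl (by simpa using hw.ne')) (Or.inl (by simp)),
    one_div, mul_comm, ← div_eq_mul_inv]
  refine ENNReal.div_le_of_le_mul ?_
  norm_cast
  omega

lemma le_lintegral_backoffLaw (j k : ℕ) :
    ENNReal.ofReal (S.Tmin * (S.r ^ j / 4)) ^ k * (1 / 2) ≤
      ∫⁻ n, ENNReal.ofReal (S.Tmin * (n + 1)) ^ k ∂S.backoffLaw j := by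
  calc ENNReal.ofReal (S.Tmin * (S.r ^ j / 4)) ^ k * (1 / 2)
      ≤ ENNReal.ofReal (S.Tmin * (S.r ^ j / 4)) ^ k *
          S.backoffLaw j (Ici (S.window j / 2)) := by gcongr; exact S.half_le_backoffLaw j
    _ = ∫⁻ _n in Ici (S.window j / 2), ENNReal.ofReal (S.Tmin * (S.r ^ j / 4)) ^ k
          ∂S.backoffLaw j := by rw [setLIntegral_const]
    _ ≤ ∫⁻ n in Ici (S.window j / 2), ENNReal.ofReal (S.Tmin * (n + 1)) ^ k ∂S.backoffLaw j := by
        refine setLIntegral_mono (by fun_prop) fun n hn => ?_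
        have h1 := S.le_window j
        have hn' : S.window j / 2 ≤ n := hn
        -- The constant `1 / 4` is one half from `le_window` and one half from restricting to the
        -- upper half of the window.
        have h2 : (S.window j : ℝ) ≤ 2 * (n + 1) := by
          have : S.window j ≤ 2 * (n + 1) := by omega
          exact_mod_cast this
        have := S.Tmin_pos
        gcongr
        linarith
    _ ≤ _ := setLIntegral_le_lintegral _ _

lemma le_lintegral_accessDelay (j k : ℕ) :
    ENNReal.ofReal (S.Tmin * (S.r ^ j / 4)) ^ k * (1 / 2) ≤
      ∫⁻ q, ENNReal.ofReal (S.accessDelay j q.1 q.2) ^ k ∂S.counterLaw := by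
  refine (S.le_lintegral_backoffLaw j k).trans ?_
  have hp : MeasurePreserving (fun q : (ℕ → ℕ) × (ℕ → ℕ → ℝ) => q.1 j) S.counterLaw
      (S.backoffLaw j) :=
    (measurePreserving_eval_infinitePi S.backoffLaw j).comp measurePreserving_fst
  rw [← hp.lintegral_comp (f := fun n : ℕ => ENNReal.ofReal (S.Tmin * (n + 1)) ^ k) (by fun_prop)]
  refine lintegral_mono_ae ?_
  filter_upwards [S.ae_counterLaw] with q hq
  gcongr
  exact S.le_accessDelay hq.2

/-- The `k`-th moment of the medium-access delay is finite exactly for `p_c r ^ k < 1`. -/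
theorem posMoment_accessLaw_lt_top_iff (k : ℕ) :
    posMoment S.accessLaw k < ∞ ↔ S.pc * S.r ^ k < 1 := by
  have hp0 := S.pc_nonneg
  have hp1 : S.pc < 1 := S.collisionProb_lt_one
  have hr0 : 0 < S.r := zero_lt_one.trans S.one_lt_r
  have hq : 0 < 1 - S.pc := by linarith
  rw [posMoment_accessLaw]
  constructor
  · intro h
    by_contra! hge
    refine h.ne (top_le_iff.mp ?_)
    have hT := S.Tmin_pos
    have hc : ENNReal.ofReal ((1 - S.pc) * (S.Tmin / 4) ^ k) * (1 / 2) ≠ 0 := by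
      refine mul_ne_zero ?_ (by simp)
      rw [ne_eq, ENNReal.ofReal_eq_zero, not_le]
      positivity
    -- If `p_c r ^ k ≥ 1`, the terms of the moment series stay above a fixed positive constant.
    rw [← ENNReal.tsum_const_eq_top_of_ne_zero (α := ℕ) hc]
    refine ENNReal.tsum_le_tsum fun j => ?_
    refine le_trans ?_ (mul_le_mul_right (S.le_lintegral_accessDelay j k) _)
    rw [← ENNReal.ofReal_pow (by positivity), ← mul_assoc, ← ENNReal.ofReal_mul (by positivity)]
    have e : S.pc ^ j * (1 - S.pc) * (S.Tmin * (S.r ^ j / 4)) ^ k =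
        (1 - S.pc) * (S.Tmin / 4) ^ k * (S.pc * S.r ^ k) ^ j := by
      simp only [mul_pow, div_pow, ← pow_mul, mul_comm k j]
      ring
    rw [e]
    refine mul_le_mul_left (ENNReal.ofReal_le_ofReal ?_) _
    exact le_mul_of_one_le_right (by positivity) (one_le_pow₀ hge)
  · intro h
    set C := (S.Tmax * (S.W₀ + 1) + S.Tcoll + S.Tsucc) * (S.r / (S.r - 1)) with hC
    have hC0 : 0 ≤ C := by
      have := S.Tmax_pos
      have := S.Tcoll_pos
      have := S.Tsucc_pos
      have : 0 < S.r - 1 := by linarith [S.one_lt_r]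
      positivity
    calc ∑' j, ENNReal.ofReal (S.pc ^ j * (1 - S.pc)) *
          ∫⁻ q, ENNReal.ofReal (S.accessDelay j q.1 q.2) ^ k ∂S.counterLaw
        ≤ ∑' j, ENNReal.ofReal ((1 - S.pc) * C ^ k * (S.pc * S.r ^ k) ^ j) := by
          refine ENNReal.tsum_le_tsum fun j => ?_
          have hj : ∫⁻ q, ENNReal.ofReal (S.accessDelay j q.1 q.2) ^ k ∂S.counterLaw ≤
              ENNReal.ofReal (C * S.r ^ j) ^ k := by
            calc _ ≤ ∫⁻ _q, ENNReal.ofReal (C * S.r ^ j) ^ k ∂S.counterLaw := by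
                  refine lintegral_mono_ae ?_
                  filter_upwards [S.ae_counterLaw] with q hq
                  gcongr
                  exact S.accessDelay_le hq.1 hq.2
              _ = _ := by simp
          refine (mul_le_mul_right hj _).trans (le_of_eq ?_)
          rw [← ENNReal.ofReal_pow (by positivity), ← ENNReal.ofReal_mul (by positivity)]
          congr 1
          simp only [mul_pow, ← pow_mul, mul_comm k j]
          ring
      _ < ∞ := by
          have hs : Summable fun j : ℕ => (1 - S.pc) * C ^ k * (S.pc * S.r ^ k) ^ j :=
            (summable_geometric_of_lt_one (by positivity) h).mul_left _
          rw [← ENNReal.ofReal_tsum_of_nonneg (fun j => by positivity) hs]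
          exact ENNReal.ofReal_lt_top

/-! ### The queue of the tagged station. -/

lemma rhoTilde_eq : S.rhoTilde = ENNReal.ofReal S.rate * posMoment S.accessLaw 1 := by
  simp [rhoTilde, posMoment]

/-- The law of a sequence of vacations. -/
abbrev vacationsLaw : Measure (ℕ → ℝ) := Measure.infinitePi fun _ : ℕ => S.slotLaw

lemma ae_residualLaw_mem_Icc :
    ∀ᵐ x ∂residualLaw S.rate S.vacationsLaw, x ∈ Icc 0 S.Tmax :=
  MPRWLAN.ae_residualLaw_mem_Icc S.rate_pos S.Tmin_pos S.ae_slots_mem_Icc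

variable {S}

lemma IsSteadyStateDelay.rhoTilde_lt_one {μ : Measure ℝ} (h : S.IsSteadyStateDelay μ) :
    S.rhoTilde < 1 := by
  have := h.isProbabilityMeasure
  rw [rhoTilde_eq]
  exact rho_lt_one_of_stationary S.rate_pos S.ae_nonneg_accessLaw
    (S.ae_residualLaw_mem_Icc.mono fun x hx => hx.1) h.nonneg h.stationary

lemma IsSteadyStateDelay.unique {μ ν : Measure ℝ} (hμ : S.IsSteadyStateDelay μ)
    (hν : S.IsSteadyStateDelay ν) : μ = ν := by
  have := hμ.isProbabilityMeasure
  have := hν.isProbabilityMeasure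
  exact stationary_unique S.rate_pos S.ae_nonneg_accessLaw
    (S.ae_residualLaw_mem_Icc.mono fun x hx => hx.1) hμ.nonneg hν.nonneg hμ.stationary
    hν.stationary

lemma isSteadyStateDelay_delayLaw (h : S.rhoTilde < 1) :
    S.IsSteadyStateDelay (delayLaw S.rate S.accessLaw S.vacationsLaw) := by
  rw [rhoTilde_eq] at h
  exact ⟨isProbabilityMeasure_delayLaw S.rate_pos S.ae_residualLaw_mem_Icc h,
    ae_nonneg_delayLaw S.rate_pos S.ae_nonneg_accessLaw S.ae_residualLaw_mem_Icc h,
    nextDelayLaw_delayLaw S.rate_pos S.ae_nonneg_accessLaw S.Tmin_pos S.ae_slots_mem_Icc h⟩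

/-- Uniqueness identifies any stationary law with the explicit series, for which moments transfer
back to the access delay. -/
lemma IsSteadyStateDelay.pc_mul_pow_lt_one {μ : Measure ℝ} (hμ : S.IsSteadyStateDelay μ) {k : ℕ}
    (h : posMoment μ k < ∞) : S.pc * S.r ^ (k + 1) < 1 := by
  have hρ := hμ.rhoTilde_lt_one
  rw [hμ.unique (isSteadyStateDelay_delayLaw hρ)] at h
  rw [rhoTilde_eq] at hρ
  rw [← posMoment_accessLaw_lt_top_iff]
  exact posMoment_succ_lt_top_of_delayLaw S.rate_pos S.ae_nonneg_accessLaw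
    S.ae_residualLaw_mem_Icc hρ h

lemma pc_mul_pow_lt_one_of_le {m n : ℕ} (hmn : m ≤ n) (h : S.pc * S.r ^ n < 1) :
    S.pc * S.r ^ m < 1 :=
  (mul_le_mul_of_nonneg_left (pow_le_pow_right₀ S.one_lt_r.le hmn) S.pc_nonneg).trans_lt h

/-- For a probability law, finite variance is square-integrability; nonnegativity makes the
truncated second moment the full one. -/
lemma IsSteadyStateDelay.evariance_lt_top_iff {μ : Measure ℝ} (hμ : S.IsSteadyStateDelay μ) :
    evariance (fun d : ℝ => d) μ < ∞ ↔ posMoment μ 2 < ∞ := by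
  have := hμ.isProbabilityMeasure
  have hm : AEStronglyMeasurable (fun d : ℝ => d) μ := by fun_prop
  rw [evariance_lt_top_iff_memLp hm, memLp_two_iff_integrable_sq hm, Integrable,
    and_iff_right (by fun_prop), hasFiniteIntegral_iff_ofReal (ae_of_all _ fun x => sq_nonneg x),
    posMoment, lintegral_congr_ae]
  filter_upwards [hμ.nonneg] with x hx using ENNReal.ofReal_pow hx 2

end Network

end MPRWLAN

end

theorem theorem3 (S : MPRWLAN.Network) :
    -- the steady-state delay `D` exists if and only if `ρ̃ < 1`, and its law is unique
    ((∃ μ, S.IsSteadyStateDelay μ) ↔ S.rhoTilde < 1) ∧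
    (∀ μ ν, S.IsSteadyStateDelay μ → S.IsSteadyStateDelay ν → μ = ν) ∧
    -- it has a finite mean if and only if `ρ̃ < 1` and `p_c < 1 / r ^ 2`
    ((∃ μ, S.IsSteadyStateDelay μ ∧ ∫⁻ d, ENNReal.ofReal d ∂μ < ∞) ↔
      S.rhoTilde < 1 ∧ S.pc < 1 / S.r ^ 2) ∧
    -- it has a finite variance if and only if `ρ̃ < 1` and `p_c < 1 / r ^ 3`
    ((∃ μ, S.IsSteadyStateDelay μ ∧ evariance (fun d : ℝ => d) μ < ∞) ↔
      S.rhoTilde < 1 ∧ S.pc < 1 / S.r ^ 3) := by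
  have hr : 0 < S.r := zero_lt_one.trans S.one_lt_r
  have hmom (k : ℕ) (h : S.pc * S.r ^ k < 1) : MPRWLAN.posMoment S.accessLaw k < ∞ :=
    (S.posMoment_accessLaw_lt_top_iff k).mpr h
  rw [lt_div_iff₀ (by positivity), lt_div_iff₀ (by positivity)]
  refine ⟨⟨fun ⟨μ, hμ⟩ => hμ.rhoTilde_lt_one,
      fun h => ⟨_, MPRWLAN.Network.isSteadyStateDelay_delayLaw h⟩⟩,
    fun μ ν hμ hν => hμ.unique hν, ⟨?_, ?_⟩, ⟨?_, ?_⟩⟩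
  · rintro ⟨μ, hμ, h⟩
    exact ⟨hμ.rhoTilde_lt_one, hμ.pc_mul_pow_lt_one (k := 1) (by simpa [MPRWLAN.posMoment] using h)⟩
  · rintro ⟨hρ, h2⟩
    refine ⟨_, MPRWLAN.Network.isSteadyStateDelay_delayLaw hρ, ?_⟩
    have := MPRWLAN.posMoment_one_delayLaw_lt_top S.rate_pos S.ae_nonneg_accessLaw
      S.ae_residualLaw_mem_Icc (by rwa [S.rhoTilde_eq] at hρ)
      (hmom 1 (MPRWLAN.Network.pc_mul_pow_lt_one_of_le one_le_two h2)) (hmom 2 h2)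
    simpa [MPRWLAN.posMoment] using this
  · rintro ⟨μ, hμ, h⟩
    exact ⟨hμ.rhoTilde_lt_one, hμ.pc_mul_pow_lt_one (k := 2) (hμ.evariance_lt_top_iff.mp h)⟩
  · rintro ⟨hρ, h3⟩
    have hD := MPRWLAN.Network.isSteadyStateDelay_delayLaw hρ
    refine ⟨_, hD, hD.evariance_lt_top_iff.mpr ?_⟩
    exact MPRWLAN.posMoment_two_delayLaw_lt_top S.rate_pos S.ae_nonneg_accessLaw
      S.ae_residualLaw_mem_Icc (by rwa [S.rhoTilde_eq] at hρ)
      (hmom 1 (MPRWLAN.Network.pc_mul_pow_lt_one_of_le (by norm_num) h3))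
      (hmom 2 (MPRWLAN.Network.pc_mul_pow_lt_one_of_le (by norm_num) h3)) (hmom 3 h3)
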